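/- Let $d\ge 1$, $\beta>0$, and let $\phi:[0,\infty)\to[0,+\infty]$ be measurable (a repulsive, translation-invariant pair potential, with $e^{-\infty}=0$) such that $C(\beta)=\int_{\mathbb R^d}|e^{-\beta\phi(|x|)}-1|\,dx<\infty$. For a finite region $\Lambda\subset\mathbb R^d$ (measurable, $0<|\Lambda|<\infty$) and $z\in\mathbb C$ put $$\Xi_\Lambda(z)=1+\sum_{N\ge1}\frac{z^N}{N!}\int_{\Lambda^N}e^{-\beta\sum_{i<j}\phi(|x_i-x_j|)}dx_1\cdots dx_N,\qquad \beta P_\Lambda(z)=\frac1{|\Lambda|}\ln\Xi_\Lambda(z),$$ where $\ln\Xi_\Lambda$ is the branch of the logarithm obtained by continuation from $\ln\Xi_\Lambda(0)=0$ along the segment from $0$ to $z$, and let $\beta p(z)=\lim_{\Lambda\uparrow\mathbb R^d}\beta P_\Lambda(z)$, where $\Lambda\uparrow\mathbb R^d$ is along arbitrary sequences of finite regions in the sense of van Hove (volumes tending to infinity, and for each $h>0$ the $h$-neighbourhood of $\partial\Lambda$ has volume $o(|\Lambda|)$; this includes convergence in the sense of Fisher). Let $$\varphi_n(x;x_1,\dots,x_n)=\prod_{i}\bigl[1-e^{-\beta\phi(|x-x_i|)}\bigr]\prod_{i<j}e^{-\beta\phi(|x_i-x_j|)},\quad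 \varphi_0=1,$$ $$\Psi(\mu)=1+\sum_{n\ge1}\frac{\mu^n}{n!}\int_{\mathbb R^{dn}}\varphi_n(0;x_1,\dots,x_n)\,dx_1\cdots dx_n,$$ $$\mathcal B(r)=1+\sum_{n\ge1}\frac{r^n}{n!}\int_{\mathbb R^{dn}}\sum_{\tau}\prod_{i=0}^n\varphi_{s_i}\bigl(x_i;x_{(i,1)},\dots,x_{(i,s_i)}\bigr)dx_1\cdots dx_n\in[1,+\infty],\quad x_0=0,$$ where $\tau$ runs over the trees with vertex set $\{0,\dots,n\}$ rooted at $0$, and $(i,1),\dots,(i,s_i)$ are the children of the vertex $i$ in $\tau$. **Theorem.** Let $z\in\mathbb C$ and $\mu\in(0,\infty)$ satisfy $|z|\le\mu/\Psi(\mu)$, and let $\Pi_z(x)=|z|\Psi(x)$, with $n$-fold composition $\Pi_z^n$. Then: 1. For every finite region $\Lambda$, $\Xi_\Lambda$ has no zero in $\{|\zeta|\le|z|\}$ (so $\beta P_\Lambda(z)$ is well defined, and $e^{|\Lambda|\beta P_\Lambda(z)}=\Xi_\Lambda(z)$), the limit $\beta p(z)$ exists, and $$|\beta P_\Lambda(z)|,\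 |\beta p(z)|\ \le\ |z|\,\mathcal B(|z|)\ \le\ \mu .$$ 2. $\Pi_z$ maps $[0,\infty)$ to $[0,\infty)$. The sequence $(\Pi_z^n(\mu))_{n\ge0}$ is non-increasing, and it is strictly decreasing if $0<|z|<\mu/\Psi(\mu)$ and $C(\beta)>0$. It converges to a limit $\Pi_z^\infty(\mu)$, which is a fixed point of $\Pi_z$, and $$|z|\,\mathcal B(|z|)\le\Pi_z^\infty(\mu)\le\cdots\le\Pi_z^n(\mu)\le\cdots\le\Pi_z(\mu)\le\mu .$$ -/

import Mathlib

open scoped ENNReal NNReal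

namespace RepulsiveGas

/-- Position space `ℝ^d` with its Euclidean distance and Lebesgue measure. -/
abbrev Pos (d : ℕ) : Type := EuclideanSpace ℝ (Fin d)

/-- The Boltzmann factor `exp (-β u)` of an energy `u ∈ [0, +∞]`, with `exp (-∞) = 0`. -/
noncomputable def boltzmann (β : ℝ) (u : ℝ≥0∞) : ℝ :=
  if u = ⊤ then 0 else Real.exp (-(β * u.toReal))

/-- The two-body weight `exp (-β φ(|x - y|))`. -/
noncomputable def pairWeight {d : ℕ} (β : ℝ) (φ : ℝ≥0 → ℝ≥0∞) (x y : Pos d) : ℝ :=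
  boltzmann β (φ (nndist x y))

/-- The temperedness constant `C(β) = ∫ |exp (-β φ(|x|)) - 1| dx ∈ [0, +∞]`. -/
noncomputable def tempering (d : ℕ) (β : ℝ) (φ : ℝ≥0 → ℝ≥0∞) : ℝ≥0∞ :=
  ∫⁻ x : Pos d, ENNReal.ofReal |pairWeight β φ x 0 - 1|

/-- The potential energy `U_N(x₁, …, x_N) = ∑_{i < j} φ(|x_i - x_j|)`. -/
noncomputable def energy {d : ℕ} (φ : ℝ≥0 → ℝ≥0∞) {N : ℕ} (x : Fin N → Pos d) : ℝ≥0∞ :=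
  ∑ p : Fin N × Fin N with p.1 < p.2, φ (nndist (x p.1) (x p.2))

/-- A finite region: a measurable set of positive and finite Lebesgue measure. -/
structure IsRegion {d : ℕ} (Λ : Set (Pos d)) : Prop where
  measurable : MeasurableSet Λ
  pos : 0 < MeasureTheory.volume Λ
  finite : MeasureTheory.volume Λ < ⊤

/-- The grand canonical partition function
`Ξ_Λ(z) = 1 + ∑_{N ≥ 1} (z^N / N!) ∫_{Λ^N} exp (-β U_N(x₁, …, x_N)) dx₁ ⋯ dx_N`
(the term `N = 0` of the sum below is `1`). -/
noncomputable def partitionFunction {d : ℕ} (β : ℝ) (φ : ℝ≥0 → ℝ≥0∞) (Λ : Set (Pos d))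
    (z : ℂ) : ℂ :=
  ∑' N : ℕ, z ^ N / (N.factorial : ℂ) *
    ((∫ x : Fin N → Pos d in Set.univ.pi (fun _ => Λ), boltzmann β (energy φ x) : ℝ) : ℂ)

/-- The logarithm of an entire function `F` with `F 0 = 1`, determined by continuation from
`log (F 0) = 0` along the segment from `0` to `z`, that is `∫₀^z F'(ζ) / F(ζ) dζ`. It is
meaningful when `F` has no zero on that segment. -/
noncomputable def logFromOrigin (F : ℂ → ℂ) (z : ℂ) : ℂ :=
  ∫ t in (0 : ℝ)..1, z * (deriv F ((t : ℂ) * z) / F ((t : ℂ) * z))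

/-- The finite-volume pressure `β P_Λ(z) = |Λ|⁻¹ log Ξ_Λ(z)`. -/
noncomputable def betaPressure {d : ℕ} (β : ℝ) (φ : ℝ≥0 → ℝ≥0∞) (Λ : Set (Pos d))
    (z : ℂ) : ℂ :=
  logFromOrigin (partitionFunction β φ Λ) z / ((MeasureTheory.volume Λ).toReal : ℂ)

/-- `Λ_k ↑ ℝ^d` in the sense of van Hove: the volumes tend to infinity and, for every `h > 0`, the
`h`-neighbourhood of the boundary has asymptotically negligible relative volume. Every sequence
which tends to infinity in the sense of Fisher does so in the sense of van Hove. -/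
structure TendsToSpace {d : ℕ} (Λ : ℕ → Set (Pos d)) : Prop where
  region : ∀ k, IsRegion (Λ k)
  volume : Filter.Tendsto (fun k => MeasureTheory.volume (Λ k)) Filter.atTop (nhds ⊤)
  boundary : ∀ h : ℝ, 0 < h → Filter.Tendsto
    (fun k => MeasureTheory.volume (Metric.thickening h (frontier (Λ k))) /
      MeasureTheory.volume (Λ k)) Filter.atTop (nhds 0)

/-- `q` is the thermodynamic pressure `β p(z) = lim_{Λ ↑ ℝ^d} β P_Λ(z)`. -/
def IsThermodynamicPressure (d : ℕ) (β : ℝ) (φ : ℝ≥0 → ℝ≥0∞) (z q : ℂ) : Prop :=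
  ∀ Λ : ℕ → Set (Pos d), TendsToSpace Λ →
    Filter.Tendsto (fun k => betaPressure β φ (Λ k) z) Filter.atTop (nhds q)

/-- The vertex weight
`∏_{i ∈ s} (1 - exp (-β φ(|y - x_i|))) ∏_{i < j in s} exp (-β φ(|x_i - x_j|))`,
that is `φ_n(y; x_{i₁}, …, x_{i_n})` when `s = {i₁, …, i_n}` has `n` elements. -/
noncomputable def vertexWeight {d : ℕ} (β : ℝ) (φ : ℝ≥0 → ℝ≥0∞) {m : ℕ} (y : Pos d)
    (s : Finset (Fin m)) (x : Fin m → Pos d) : ℝ :=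
  (∏ i ∈ s, (1 - pairWeight β φ y (x i))) *
    ∏ p ∈ (s ×ˢ s).filter (fun p => p.1 < p.2), pairWeight β φ (x p.1) (x p.2)

/-- `g(n) = ∫ φ_n(0; x₁, …, x_n) dx₁ ⋯ dx_n`. -/
noncomputable def vertexIntegral (d : ℕ) (β : ℝ) (φ : ℝ≥0 → ℝ≥0∞) (n : ℕ) : ℝ≥0∞ :=
  ∫⁻ x : Fin n → Pos d, ENNReal.ofReal (vertexWeight β φ 0 Finset.univ x)

/-- The vertex sum `Ψ(μ) = 1 + ∑_{n ≥ 1} (μ^n / n!) g(n)` (the term `n = 0` is `1`). -/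
noncomputable def vertexSum (d : ℕ) (β : ℝ) (φ : ℝ≥0 → ℝ≥0∞) (μ : ℝ≥0∞) : ℝ≥0∞ :=
  ∑' n : ℕ, μ ^ n / (n.factorial : ℝ≥0∞) * vertexIntegral d β φ n

open scoped Classical in
/-- The children of the vertex `i` in a tree on `{0, …, n}` rooted at `0`: the neighbours of `i`
whose distance to the root is one more than that of `i`. -/
noncomputable def children {n : ℕ} (τ : SimpleGraph (Fin (n + 1))) (i : Fin (n + 1)) :
    Finset (Fin (n + 1)) :=
  {j | τ.Adj i j ∧ τ.dist 0 j = τ.dist 0 i + 1}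

open scoped Classical in
/-- `B_n(x₀; x₁, …, x_n)`: the sum over the trees on `{0, …, n}`, rooted at `0`, of the product over
the vertices of the vertex weight of a vertex and its children. -/
noncomputable def treeWeight {d : ℕ} (β : ℝ) (φ : ℝ≥0 → ℝ≥0∞) {n : ℕ}
    (x : Fin (n + 1) → Pos d) : ℝ :=
  ∑ τ : SimpleGraph (Fin (n + 1)) with τ.IsTree,
    ∏ i : Fin (n + 1), vertexWeight β φ (x i) (children τ i) x

/-- The tree sum `𝓑(r) = 1 + ∑_{n ≥ 1} (r^n / n!) ∫ B_n(0; x₁, …, x_n) dx₁ ⋯ dx_n`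
(the term `n = 0` is `1`), with value `+∞` when the series diverges. -/
noncomputable def treeSum (d : ℕ) (β : ℝ) (φ : ℝ≥0 → ℝ≥0∞) (r : ℝ≥0∞) : ℝ≥0∞ :=
  ∑' n : ℕ, r ^ n / (n.factorial : ℝ≥0∞) *
    ∫⁻ x : Fin n → Pos d,
      ENNReal.ofReal (treeWeight β φ (Fin.cons (0 : Pos d) x : Fin (n + 1) → Pos d))

/-- The map `Π_z(x) = |z| Ψ(x)`. -/
noncomputable def vertexMap (d : ℕ) (β : ℝ) (φ : ℝ≥0 → ℝ≥0∞) (z : ℂ) (x : ℝ≥0∞) : ℝ≥0∞ :=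
  ‖z‖ₑ * vertexSum d β φ x

end RepulsiveGas

namespace RepulsiveGas

open MeasureTheory Finset

/-! ### Boltzmann factors and pair weights. -/

section PairWeight

variable {d : ℕ} {β : ℝ} {φ : ℝ≥0 → ℝ≥0∞}

/-! Replace the indicator of Λ by an activity profile `w` with values in [0,1], and let Z(w) be its
partition function as a formal power series in z. The constant term is 1, so the ratio of Z(w
screened by fixed particles u₁,…,u_k) to Z(w) exists as a formal series before anything is known
about convergence or zeros. Writing e^{-βφ} = 1 - (1 - e^{-βφ}) for the interactions with u₁ and
expanding over subsets of the particles gives the Kirkwood-Salsburg identity: u₁ is traded for n new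
fixed particles t, with weight (-z)ⁿ/n! φ_n(u₁;t), integrated over t against activities at most 1.
In absolute value this is exactly the recursion `forestCoeff`, which counts forests with k roots,
explored root by root, when a vertex with n children weighs g(n) = ∫ φ_n. Hence
`IsActivity.enorm_coeff_ratio_le`.

The same exploration evaluates the tree sum: `forestSum_explore` and `lmarginal_forestSum` give 𝓑(r)
= ∑ rⁿ `forestCoeff g 1 n` (`treeSum_eq`). If r Ψ(y) ≤ y, then induction bounds the truncated
generating functions of forests with k roots by yᵏ (`sum_range_forestCoeff_le`). So r 𝓑(r) lies
below every supersolution y: below μ, and below the limit of the iterates of Π_z, which is a fixed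
point because Ψ is continuous along decreasing finite sequences.

Since Z(w)' = ∫ w(y) Z(w screened by y) dy, the coefficients γ_n of Γ = Ξ'/Ξ are integrals over Λ of
one-particle ratio coefficients, so |γ_n| ≤ |Λ| `forestCoeff g 1 n`. The series Γ therefore
converges absolutely on the closed disc of radius |z|, the equation Ξ' = ΓΞ exhibits Ξ as an
exponential, and termwise integration gives βP_Λ(z) = ∑ γ_n z^{n+1}/((n+1)|Λ|). Dropping 1/(n+1)
yields the bound |z| 𝓑(|z|).

This majorant does not depend on Λ, so the thermodynamic limit reduces to the convergence of each
γ_n/|Λ|. By the recursion once more, a ratio coefficient hardly feels the profile far from the fixed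
particles (`tendsto_localityError`). In the bulk of Λ it is close to its value for a large ball, and
the boundary layer is negligible by the van Hove condition. -/

lemma boltzmann_nonneg (β : ℝ) (u : ℝ≥0∞) : 0 ≤ boltzmann β u := by
  unfold boltzmann; split_ifs <;> positivity

lemma boltzmann_le_one (hβ : 0 ≤ β) (u : ℝ≥0∞) : boltzmann β u ≤ 1 := by
  unfold boltzmann; split_ifs
  · exact zero_le_one
  · exact Real.exp_le_one_iff.2 (neg_nonpos.2 (by positivity))

@[simp] lemma boltzmann_zero (β : ℝ) : boltzmann β 0 = 1 := by simp [boltzmann]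

lemma boltzmann_add (β : ℝ) (u v : ℝ≥0∞) :
    boltzmann β (u + v) = boltzmann β u * boltzmann β v := by
  unfold boltzmann
  by_cases hu : u = ⊤
  · simp [hu]
  by_cases hv : v = ⊤
  · simp [hv]
  simp [hu, hv, ENNReal.toReal_add hu hv, ← Real.exp_add]
  ring

lemma boltzmann_sum {ι : Type*} (β : ℝ) (s : Finset ι) (u : ι → ℝ≥0∞) :
    boltzmann β (∑ i ∈ s, u i) = ∏ i ∈ s, boltzmann β (u i) := by
  classical
  induction s using Finset.induction_on with
  | empty => simp
  | insert a s ha ih => rw [sum_insert ha, prod_insert ha, boltzmann_add, ih]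

lemma measurable_boltzmann (β : ℝ) : Measurable (boltzmann β) := by
  unfold boltzmann
  exact Measurable.ite (measurableSet_singleton _) measurable_const (by fun_prop)

lemma pairWeight_nonneg (x y : Pos d) : 0 ≤ pairWeight β φ x y := boltzmann_nonneg _ _

lemma pairWeight_le_one (hβ : 0 ≤ β) (x y : Pos d) : pairWeight β φ x y ≤ 1 :=
  boltzmann_le_one hβ _

lemma pairWeight_comm (x y : Pos d) : pairWeight β φ x y = pairWeight β φ y x := by
  simp [pairWeight, nndist_comm]

lemma pairWeight_add_right (x y a : Pos d) :
    pairWeight β φ (x + a) (y + a) = pairWeight β φ x y := by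
  simp [pairWeight]

lemma measurable_pairWeight (hφ : Measurable φ) :
    Measurable (fun p : Pos d × Pos d => pairWeight β φ p.1 p.2) :=
  (measurable_boltzmann β).comp (hφ.comp (measurable_fst.nndist measurable_snd))

lemma measurable_pairWeight_comp {α : Type*} [MeasurableSpace α] {f g : α → Pos d}
    (hφ : Measurable φ) (hf : Measurable f) (hg : Measurable g) :
    Measurable (fun a => pairWeight β φ (f a) (g a)) := by
  have h := (measurable_pairWeight (β := β) hφ).comp (hf.prodMk hg)
  exact h

end PairWeight

/-! ### Interactions over label sets and splitting of configurations. -/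

/-- The product of the pair weights over the pairs of points with labels in `s`. -/
noncomputable def interaction {d : ℕ} (β : ℝ) (φ : ℝ≥0 → ℝ≥0∞) {m : ℕ} (s : Finset (Fin m))
    (x : Fin m → Pos d) : ℝ :=
  ∏ p ∈ (s ×ˢ s).filter (fun p => p.1 < p.2), pairWeight β φ (x p.1) (x p.2)

section Interaction

variable {d : ℕ} {β : ℝ} {φ : ℝ≥0 → ℝ≥0∞} {m : ℕ}

lemma vertexWeight_eq (y : Pos d) (s : Finset (Fin m)) (x : Fin m → Pos d) :
    vertexWeight β φ y s x = (∏ i ∈ s, (1 - pairWeight β φ y (x i))) * interaction β φ s x := rfl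

lemma interaction_eq (s : Finset (Fin m)) (x : Fin m → Pos d) :
    interaction β φ s x =
      ∏ i ∈ s, ∏ j ∈ s, if i < j then pairWeight β φ (x i) (x j) else 1 := by
  rw [interaction, prod_filter, prod_product]

lemma interaction_nonneg (s : Finset (Fin m)) (x : Fin m → Pos d) : 0 ≤ interaction β φ s x :=
  prod_nonneg fun _ _ => pairWeight_nonneg _ _

lemma interaction_le_one (hβ : 0 ≤ β) (s : Finset (Fin m)) (x : Fin m → Pos d) :
    interaction β φ s x ≤ 1 :=
  prod_le_one (fun _ _ => pairWeight_nonneg _ _) fun _ _ => pairWeight_le_one hβ _ _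

lemma boltzmann_energy {N : ℕ} (x : Fin N → Pos d) :
    boltzmann β (energy φ x) = interaction β φ univ x := by
  simp [energy, boltzmann_sum, interaction, pairWeight]

lemma interaction_union {s t : Finset (Fin m)} (h : Disjoint s t) (x : Fin m → Pos d) :
    interaction β φ (s ∪ t) x = interaction β φ s x * interaction β φ t x *
      ∏ i ∈ s, ∏ j ∈ t, pairWeight β φ (x i) (x j) := by
  simp only [interaction_eq]
  rw [prod_union h]
  simp_rw [prod_union h, prod_mul_distrib]
  -- Each cross pair is ordered one way or the other, so exactly one of the two mixed products
  -- contains it.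
  have key : (∏ i ∈ s, ∏ j ∈ t, if i < j then pairWeight β φ (x i) (x j) else 1) *
      (∏ i ∈ t, ∏ j ∈ s, if i < j then pairWeight β φ (x i) (x j) else 1) =
      ∏ i ∈ s, ∏ j ∈ t, pairWeight β φ (x i) (x j) := by
    rw [prod_comm (s := t), ← prod_mul_distrib]
    refine prod_congr rfl fun i hi => ?_
    rw [← prod_mul_distrib]
    refine prod_congr rfl fun j hj => ?_
    have hij : i ≠ j := fun e => disjoint_left.1 h hi (e ▸ hj)
    rcases lt_or_gt_of_ne hij with l | l
    · simp [l, l.not_gt]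
    · simp [l, l.not_gt, pairWeight_comm]
  rw [← key]; ring

lemma prod_orderEmbOfFin {M : Type*} [CommMonoid M] {n : ℕ} (s : Finset (Fin m)) (h : #s = n)
    (F : Fin m → M) : ∏ i : Fin n, F (s.orderEmbOfFin h i) = ∏ i ∈ s, F i := by
  conv_rhs => rw [← map_orderEmbOfFin_univ s h, prod_map]
  rfl

lemma interaction_orderEmbOfFin {n : ℕ} (s : Finset (Fin m)) (h : #s = n) (x : Fin m → Pos d) :
    interaction β φ univ (x ∘ s.orderEmbOfFin h) = interaction β φ s x := by
  simp only [interaction_eq, Function.comp]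
  rw [← prod_orderEmbOfFin s h]
  refine prod_congr rfl fun i _ => ?_
  rw [← prod_orderEmbOfFin s h]
  simp

lemma vertexWeight_orderEmbOfFin {n : ℕ} (y : Pos d) (s : Finset (Fin m)) (h : #s = n)
    (x : Fin m → Pos d) :
    vertexWeight β φ y univ (x ∘ s.orderEmbOfFin h) = vertexWeight β φ y s x := by
  rw [vertexWeight_eq, vertexWeight_eq, interaction_orderEmbOfFin]
  congr 1
  exact prod_orderEmbOfFin s h (fun i => 1 - pairWeight β φ y (x i))

lemma vertexWeight_nonneg (hβ : 0 ≤ β) (y : Pos d) (s : Finset (Fin m)) (x : Fin m → Pos d) :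
    0 ≤ vertexWeight β φ y s x :=
  mul_nonneg (prod_nonneg fun _ _ => sub_nonneg.2 (pairWeight_le_one hβ _ _))
    (interaction_nonneg _ _)

lemma vertexWeight_add_right (y a : Pos d) (s : Finset (Fin m)) (x : Fin m → Pos d) :
    vertexWeight β φ (y + a) s (fun i => x i + a) = vertexWeight β φ y s x := by
  simp [vertexWeight, pairWeight_add_right]

lemma measurable_interaction {α : Type*} [MeasurableSpace α] {f : α → Fin m → Pos d}
    (hφ : Measurable φ) (s : Finset (Fin m)) (hf : Measurable f) :
    Measurable (fun a => interaction β φ s (f a)) :=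
  Finset.measurable_prod _ fun p _ =>
    measurable_pairWeight_comp hφ ((measurable_pi_apply p.1).comp hf) ((measurable_pi_apply p.2).comp hf)

lemma measurable_vertexWeight {α : Type*} [MeasurableSpace α] {g : α → Pos d}
    {f : α → Fin m → Pos d} (hφ : Measurable φ) (s : Finset (Fin m)) (hg : Measurable g)
    (hf : Measurable f) : Measurable (fun a => vertexWeight β φ (g a) s (f a)) := by
  simp only [vertexWeight_eq]
  refine (Finset.measurable_prod _ fun p _ => ?_).mul (measurable_interaction hφ s hf)
  exact measurable_const.sub (measurable_pairWeight_comp hφ hg ((measurable_pi_apply p).comp hf))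

/-- The splitting of a configuration according to a set `s` of labels. -/
def splitEquiv (X : Type*) [MeasurableSpace X] {N n k : ℕ} (s : Finset (Fin N)) (hn : #s = n)
    (hk : #sᶜ = k) : (Fin N → X) ≃ᵐ (Fin n → X) × (Fin k → X) :=
  (MeasurableEquiv.piCongrLeft (fun _ : Fin N => X)
    (finSumEquivOfFinset hn hk)).symm.trans
      (MeasurableEquiv.sumPiEquivProdPi (fun _ : Fin n ⊕ Fin k => X))

lemma splitEquiv_apply {X : Type*} [MeasurableSpace X] {N n k : ℕ} (s : Finset (Fin N))
    (hn : #s = n) (hk : #sᶜ = k) (x : Fin N → X) :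
    splitEquiv X s hn hk x = (x ∘ s.orderEmbOfFin hn, x ∘ sᶜ.orderEmbOfFin hk) := rfl

lemma measurePreserving_splitEquiv {N n k : ℕ} (s : Finset (Fin N)) (hn : #s = n) (hk : #sᶜ = k) :
    MeasurePreserving (splitEquiv (Pos d) s hn hk) :=
  (volume_measurePreserving_sumPiEquivProdPi (fun _ : Fin n ⊕ Fin k => Pos d)).comp
    (volume_measurePreserving_piCongrLeft (fun _ : Fin N => Pos d)
      (finSumEquivOfFinset hn hk)).symm

end Interaction

end RepulsiveGas

/-! ### Configuration integrals and the Kirkwood-Salsburg identity. -/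

namespace RepulsiveGas

open MeasureTheory Finset

/-- A position dependent activity profile with values in `[0, 1]` and finite total mass. -/
structure IsActivity {d : ℕ} (w : Pos d → ℝ) : Prop where
  measurable : Measurable w
  nonneg : ∀ u, 0 ≤ w u
  le_one : ∀ u, w u ≤ 1
  integrable : Integrable w

/-- The configuration integral of `N` particles with activity profile `w`. -/
noncomputable def configIntegral {d : ℕ} (β : ℝ) (φ : ℝ≥0 → ℝ≥0∞) (w : Pos d → ℝ) (N : ℕ) : ℝ :=
  ∫ x : Fin N → Pos d, (∏ i, w (x i)) * interaction β φ univ x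

/-- The activity profile `w` in the presence of fixed particles at the points `u i`. -/
noncomputable def screened {d : ℕ} (β : ℝ) (φ : ℝ≥0 → ℝ≥0∞) (w : Pos d → ℝ) {n : ℕ}
    (u : Fin n → Pos d) (v : Pos d) : ℝ :=
  w v * ∏ i, pairWeight β φ (u i) v

section Config

variable {d : ℕ} {β : ℝ} {φ : ℝ≥0 → ℝ≥0∞} {w : Pos d → ℝ}

lemma measurable_screened {α : Type*} [MeasurableSpace α] (hφ : Measurable φ) (hw : Measurable w)
    {n : ℕ} {f : α → Fin n → Pos d} {g : α → Pos d} (hf : Measurable f) (hg : Measurable g) :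
    Measurable (fun a => screened β φ w (f a) (g a)) :=
  (hw.comp hg).mul (Finset.measurable_prod _ fun i _ =>
    measurable_pairWeight_comp hφ ((measurable_pi_apply i).comp hf) hg)

lemma screened_le (hβ : 0 ≤ β) (hw : ∀ u, 0 ≤ w u) {n : ℕ} (u : Fin n → Pos d) (v : Pos d) :
    screened β φ w u v ≤ w v :=
  mul_le_of_le_one_right (hw v)
    (prod_le_one (fun _ _ => pairWeight_nonneg _ _) fun _ _ => pairWeight_le_one hβ _ _)

lemma screened_nonneg (hw : ∀ u, 0 ≤ w u) {n : ℕ} (u : Fin n → Pos d) (v : Pos d) :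
    0 ≤ screened β φ w u v :=
  mul_nonneg (hw v) (prod_nonneg fun _ _ => pairWeight_nonneg _ _)

/-- Repulsion only lowers the activity, so the class of profiles is closed under fixing particles.
This lets the recursion be applied to its own output. -/
lemma IsActivity.isActivity_screened (hw : IsActivity w) (hβ : 0 ≤ β) (hφ : Measurable φ) {n : ℕ}
    (u : Fin n → Pos d) : IsActivity (screened β φ w u) where
  measurable := measurable_screened hφ hw.measurable measurable_const measurable_id
  nonneg := screened_nonneg hw.nonneg u
  le_one v := (screened_le hβ hw.nonneg u v).trans (hw.le_one v)
  integrable := hw.integrable.mono'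
    (measurable_screened hφ hw.measurable measurable_const measurable_id).aestronglyMeasurable
    (ae_of_all _ fun v => by
      rw [Real.norm_of_nonneg (screened_nonneg hw.nonneg u v)]
      exact screened_le hβ hw.nonneg u v)

lemma IsActivity.integrable_prod (hw : IsActivity w) (n : ℕ) :
    Integrable (fun x : Fin n → Pos d => ∏ i, w (x i)) :=
  Integrable.fintype_prod (f := fun _ => w) fun _ => hw.integrable

lemma prod_activity_nonneg (hw : ∀ u, 0 ≤ w u) {n : ℕ} (x : Fin n → Pos d) :
    0 ≤ ∏ i, w (x i) := prod_nonneg fun _ _ => hw _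

lemma IsActivity.measurable_prod (hw : IsActivity w) (n : ℕ) :
    Measurable (fun x : Fin n → Pos d => ∏ i, w (x i)) :=
  Finset.measurable_prod _ fun i _ => hw.measurable.comp (measurable_pi_apply i)

lemma configIntegral_nonneg (hw : ∀ u, 0 ≤ w u) (N : ℕ) : 0 ≤ configIntegral β φ w N :=
  integral_nonneg fun x => mul_nonneg (prod_activity_nonneg hw x) (interaction_nonneg _ _)

lemma IsActivity.integrable_config (hw : IsActivity w) (hβ : 0 ≤ β) (hφ : Measurable φ) (N : ℕ) :
    Integrable (fun x : Fin N → Pos d => (∏ i, w (x i)) * interaction β φ univ x) := by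
  refine (hw.integrable_prod N).mono' ((hw.measurable_prod N).mul
    (measurable_interaction hφ _ measurable_id)).aestronglyMeasurable (ae_of_all _ fun x => ?_)
  rw [Real.norm_of_nonneg (mul_nonneg (prod_activity_nonneg hw.nonneg x) (interaction_nonneg _ _))]
  exact mul_le_of_le_one_right (prod_activity_nonneg hw.nonneg x) (interaction_le_one hβ _ _)

lemma IsActivity.configIntegral_le (hw : IsActivity w) (hβ : 0 ≤ β) (hφ : Measurable φ) (N : ℕ) :
    configIntegral β φ w N ≤ (∫ u, w u) ^ N := by
  have h := integral_fintype_prod_volume_eq_pow (ι := Fin N) w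
  rw [Fintype.card_fin] at h
  rw [← h]
  refine integral_mono (hw.integrable_config hβ hφ N) (hw.integrable_prod N) fun x => ?_
  exact mul_le_of_le_one_right (prod_activity_nonneg hw.nonneg x) (interaction_le_one hβ _ _)

@[simp] lemma configIntegral_zero (w : Pos d → ℝ) : configIntegral β φ w 0 = 1 := by
  simp [configIntegral, interaction, Measure.real, volume_pi]

lemma measurable_configIntegral {α : Type*} [MeasurableSpace α] (hφ : Measurable φ)
    {W : α → Pos d → ℝ} (hW : Measurable (fun p : α × Pos d => W p.1 p.2)) (N : ℕ) :
    Measurable (fun a => configIntegral β φ (W a) N) := by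
  have : Measurable (fun p : α × (Fin N → Pos d) =>
      (∏ i, W p.1 (p.2 i)) * interaction β φ univ p.2) := by
    refine (Finset.measurable_prod _ fun i _ => ?_).mul
      (measurable_interaction hφ _ measurable_snd)
    exact hW.comp (measurable_fst.prodMk ((measurable_pi_apply i).comp measurable_snd))
  exact (this.stronglyMeasurable.integral_prod_right').measurable

lemma configIntegral_comp_add (w : Pos d → ℝ) (a : Pos d) (N : ℕ) :
    configIntegral β φ (fun u => w (u + a)) N = configIntegral β φ w N := by
  have h := integral_add_right_eq_self (μ := (volume : Measure (Fin N → Pos d)))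
    (fun x : Fin N → Pos d => (∏ i, w (x i)) * interaction β φ univ x) (fun _ => a)
  unfold configIntegral
  rw [← h]
  simp [interaction, pairWeight_add_right]

/-- Integration over a configuration, by splitting off the particles with labels in `s`. -/
lemma IsActivity.integral_split (hw : IsActivity w) (hβ : 0 ≤ β) (hφ : Measurable φ) {N n k : ℕ}
    (s : Finset (Fin N)) (hn : #s = n) (hk : #sᶜ = k) {H : (Fin n → Pos d) → ℝ}
    (hH : Measurable H) (hH1 : ∀ u, |H u| ≤ 1) :
    ∫ x : Fin N → Pos d, H (x ∘ s.orderEmbOfFin hn) *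
        ((∏ i, w (x i)) * interaction β φ univ x) =
      ∫ u : Fin n → Pos d, H u * ((∏ i, w (u i)) * interaction β φ univ u) *
        configIntegral β φ (screened β φ w u) k := by
  -- The cross interactions between the two groups are absorbed into the screened activities of the
  -- second group.
  let K : (Fin n → Pos d) × (Fin k → Pos d) → ℝ := fun p =>
    H p.1 * ((∏ i, w (p.1 i)) * interaction β φ univ p.1) *
      ((∏ j, screened β φ w p.1 (p.2 j)) * interaction β φ univ p.2)
  have hK : ∀ x : Fin N → Pos d, H (x ∘ s.orderEmbOfFin hn) *
      ((∏ i, w (x i)) * interaction β φ univ x) = K (splitEquiv (Pos d) s hn hk x) := by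
    intro x
    simp only [K, splitEquiv_apply, interaction_orderEmbOfFin, screened, prod_mul_distrib]
    have e1 : (univ : Finset (Fin N)) = s ∪ sᶜ := (union_compl s).symm
    rw [e1, interaction_union disjoint_compl_right, prod_union disjoint_compl_right,
      ← prod_orderEmbOfFin s hn (fun i => w (x i)), ← prod_orderEmbOfFin sᶜ hk (fun i => w (x i)),
      ← prod_orderEmbOfFin s hn]
    have : ∀ i, ∏ j ∈ sᶜ, pairWeight β φ (x i) (x j) =
        ∏ j, pairWeight β φ (x i) (x (sᶜ.orderEmbOfFin hk j)) := fun i =>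
      (prod_orderEmbOfFin sᶜ hk (fun j => pairWeight β φ (x i) (x j))).symm
    simp_rw [this]
    rw [prod_comm]
    simp only [Function.comp]
    ring
  have hKm : Measurable K := by
    refine ((hH.comp measurable_fst).mul (((hw.measurable_prod n).comp measurable_fst).mul
      (measurable_interaction hφ _ measurable_fst))).mul ((Finset.measurable_prod _ fun j _ => ?_).mul
      (measurable_interaction hφ _ measurable_snd))
    exact measurable_screened hφ hw.measurable measurable_fst
      ((measurable_pi_apply j).comp measurable_snd)
  have hKi : Integrable K := by
    refine ((hw.integrable_prod n).mul_prod (hw.integrable_prod k)).mono' hKm.aestronglyMeasurable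
      (ae_of_all _ fun p => ?_)
    have a1 := prod_activity_nonneg hw.nonneg p.1
    have a2 := prod_activity_nonneg (screened_nonneg (β := β) (φ := φ) hw.nonneg p.1) p.2
    have a3 : ∏ j, screened β φ w p.1 (p.2 j) ≤ ∏ j, w (p.2 j) :=
      prod_le_prod (fun _ _ => screened_nonneg hw.nonneg _ _) fun _ _ => screened_le hβ hw.nonneg _ _
    simp only [K, norm_mul, Real.norm_eq_abs, abs_of_nonneg a1, abs_of_nonneg a2,
      abs_of_nonneg (interaction_nonneg (β := β) (φ := φ) univ p.1),
      abs_of_nonneg (interaction_nonneg (β := β) (φ := φ) univ p.2)]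
    have i1 := interaction_le_one (φ := φ) hβ univ p.1
    have i2 := interaction_le_one (φ := φ) hβ univ p.2
    have i1' := interaction_nonneg (β := β) (φ := φ) univ p.1
    have i2' := interaction_nonneg (β := β) (φ := φ) univ p.2
    calc _ ≤ 1 * ((∏ i, w (p.1 i)) * 1) * ((∏ j, w (p.2 j)) * 1) := by
          gcongr
          · exact hH1 _
          · exact prod_activity_nonneg hw.nonneg p.2
      _ = _ := by ring
  simp_rw [hK]
  rw [(measurePreserving_splitEquiv s hn hk).integral_comp', Measure.volume_eq_prod,
    integral_prod _ hKi]
  simp only [K, integral_const_mul, configIntegral]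

/-- Adding a particle. -/
lemma IsActivity.configIntegral_succ (hw : IsActivity w) (hβ : 0 ≤ β) (hφ : Measurable φ) (N : ℕ) :
    configIntegral β φ w (N + 1) =
      ∫ y, w y * configIntegral β φ (screened β φ w (fun _ : Fin 1 => y)) N := by
  have h := hw.integral_split hβ hφ (N := N + 1) (n := 1) (k := N) {0} (by simp)
    (by simp [card_compl]) (H := fun _ => 1) measurable_const (by simp)
  simp only [one_mul] at h
  rw [configIntegral, h]
  have h2 := (volume_preserving_funUnique (Fin 1) (Pos d)).integral_comp'
    (fun y => w y * configIntegral β φ (screened β φ w (fun _ : Fin 1 => y)) N)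
  rw [← h2]
  refine integral_congr_ae (ae_of_all _ fun u => ?_)
  have : (fun _ : Fin 1 => u 0) = u := by
    ext1 i; rw [Subsingleton.elim i 0]
  simp [interaction_eq, MeasurableEquiv.funUnique, this]

/-- The Kirkwood-Salsburg identity for configuration integrals. -/
lemma IsActivity.configIntegral_screened (hw : IsActivity w) (hβ : 0 ≤ β) (hφ : Measurable φ)
    (y : Pos d) (N : ℕ) :
    configIntegral β φ (screened β φ w (fun _ : Fin 1 => y)) N =
      ∑ n ∈ range (N + 1), (N.choose n : ℝ) * ((-1) ^ n *
        ∫ u : Fin n → Pos d, vertexWeight β φ y univ u * (∏ i, w (u i)) *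
          configIntegral β φ (screened β φ w u) (N - n)) := by
  -- Expansion of ∏ (1 + f_i) over subsets, with f_i = -(1 - e^{-βφ(|y - x_i|)}). Particles outside
  -- `s` no longer feel `y`, only each other and those in `s`.
  have key : ∀ x : Fin N → Pos d,
      (∏ i, screened β φ w (fun _ : Fin 1 => y) (x i)) * interaction β φ univ x =
      ∑ s ∈ (univ : Finset (Fin N)).powerset, (-1) ^ #s *
        ((∏ i : Fin #s, (1 - pairWeight β φ y ((x ∘ s.orderEmbOfFin rfl) i))) *
          ((∏ i, w (x i)) * interaction β φ univ x)) := by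
    intro x
    have : ∀ i, screened β φ w (fun _ : Fin 1 => y) (x i) =
        w (x i) * (1 + -(1 - pairWeight β φ y (x i))) := fun i => by simp [screened]
    simp_rw [this, prod_mul_distrib, prod_one_add, prod_neg]
    rw [mul_sum, sum_mul]
    refine sum_congr rfl fun s _ => ?_
    have := prod_orderEmbOfFin s rfl (fun i => 1 - pairWeight β φ y (x i))
    simp only [Function.comp, this]
    ring
  have hH : ∀ n, Measurable (fun u : Fin n → Pos d => ∏ i, (1 - pairWeight β φ y (u i))) :=
    fun n => Finset.measurable_prod _ fun i _ => measurable_const.sub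
      (measurable_pairWeight_comp hφ measurable_const (measurable_pi_apply i))
  have hH1 : ∀ n (u : Fin n → Pos d), |∏ i, (1 - pairWeight β φ y (u i))| ≤ 1 := fun n u => by
    rw [abs_of_nonneg (prod_nonneg fun _ _ => sub_nonneg.2 (pairWeight_le_one hβ _ _))]
    exact prod_le_one (fun _ _ => sub_nonneg.2 (pairWeight_le_one hβ _ _))
      fun _ _ => sub_le_self _ (pairWeight_nonneg _ _)
  rw [configIntegral]
  simp_rw [key]
  rw [integral_finsetSum]
  -- The integral depends on `s` only through its cardinality, which produces the binomial
  -- coefficient.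
  · have h2 : ∀ s ∈ (univ : Finset (Fin N)).powerset,
        ∫ x : Fin N → Pos d, (-1) ^ #s *
        ((∏ i : Fin #s, (1 - pairWeight β φ y ((x ∘ s.orderEmbOfFin rfl) i))) *
          ((∏ i, w (x i)) * interaction β φ univ x)) =
        (fun n => (-1) ^ n * ∫ u : Fin n → Pos d, vertexWeight β φ y univ u * (∏ i, w (u i)) *
          configIntegral β φ (screened β φ w u) (N - n)) #s := by
      intro s _
      have := hw.integral_split hβ hφ s rfl (by simp [card_compl]) (k := N - #s)
        (hH #s) (hH1 #s)
      rw [integral_const_mul, this]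
      simp only [vertexWeight_eq]
      congr 2
      ext u
      ring
    rw [sum_congr rfl h2]
    rw [sum_powerset_apply_card (fun n => (-1 : ℝ) ^ n *
      ∫ u : Fin n → Pos d, vertexWeight β φ y univ u * (∏ i, w (u i)) *
        configIntegral β φ (screened β φ w u) (N - n))]
    simp
  · intro s _
    refine Integrable.const_mul ?_ _
    refine (hw.integrable_config hβ hφ N).mono' (Measurable.aestronglyMeasurable ?_)
      (ae_of_all _ fun x => ?_)
    · have hc : Measurable (fun x : Fin N → Pos d => x ∘ s.orderEmbOfFin rfl) :=
        measurable_pi_lambda _ fun i => measurable_pi_apply _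
      exact ((hH #s).comp hc).mul ((hw.measurable_prod N).mul
        (measurable_interaction hφ _ measurable_id))
    rw [norm_mul, Real.norm_of_nonneg (mul_nonneg (prod_activity_nonneg hw.nonneg x)
      (interaction_nonneg _ _))]
    exact mul_le_of_le_one_left (mul_nonneg (prod_activity_nonneg hw.nonneg x)
      (interaction_nonneg _ _)) (hH1 _ _)

end Config

end RepulsiveGas

/-! ### Forest numbers and formal partition functions. -/

namespace RepulsiveGas

open MeasureTheory Finset

/-- The weighted count of forests with `k` roots and `m` further labelled vertices, divided by
`m!`, when a vertex with `j` children has weight `g j`; computed by exploring one root after the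
other. -/
noncomputable def forestCoeff (g : ℕ → ℝ≥0∞) : ℕ → ℕ → ℝ≥0∞
  | 0, 0 => 1
  | 0, _ + 1 => 0
  | k + 1, m => ∑ j : Fin (m + 1), g j / (j : ℕ).factorial * forestCoeff g (j + k) (m - j)
-- Exploring a root with `j` children leads from (k + 1, m) to (j + k, m - j), so the total drops by
-- one.
termination_by k m => k + m
decreasing_by have := j.2; omega

lemma forestCoeff_zero (g : ℕ → ℝ≥0∞) (m : ℕ) : forestCoeff g 0 m = if m = 0 then 1 else 0 := by
  cases m <;> simp [forestCoeff]

lemma forestCoeff_succ (g : ℕ → ℝ≥0∞) (k m : ℕ) :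
    forestCoeff g (k + 1) m =
      ∑ j ∈ range (m + 1), g j / j.factorial * forestCoeff g (j + k) (m - j) := by
  rw [forestCoeff, Finset.sum_range]

/-- The grand canonical partition function with activity profile `w`, as a power series in the
activity. -/
noncomputable def configSeries {d : ℕ} (β : ℝ) (φ : ℝ≥0 → ℝ≥0∞) (w : Pos d → ℝ) :
    PowerSeries ℝ :=
  PowerSeries.mk fun N => configIntegral β φ w N / N.factorial

section Series

variable {d : ℕ} {β : ℝ} {φ : ℝ≥0 → ℝ≥0∞} {w : Pos d → ℝ}

lemma constantCoeff_configSeries (w : Pos d → ℝ) :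
    PowerSeries.constantCoeff (configSeries β φ w) = 1 := by
  rw [← PowerSeries.coeff_zero_eq_constantCoeff_apply]
  simp [configSeries]

/-- The constant term 1 makes division legitimate for formal series, so ratios can be used before
zero-freeness is proved. -/
lemma configSeries_mul_inv (w : Pos d → ℝ) :
    configSeries β φ w * (configSeries β φ w)⁻¹ = 1 :=
  PowerSeries.mul_inv_cancel _ (by simp [constantCoeff_configSeries])

lemma measurable_coeff_configSeries {α : Type*} [MeasurableSpace α] (hφ : Measurable φ)
    {W : α → Pos d → ℝ} (hW : Measurable (fun p : α × Pos d => W p.1 p.2)) (I : PowerSeries ℝ)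
    (m : ℕ) : Measurable (fun a => PowerSeries.coeff m (configSeries β φ (W a) * I)) := by
  simp only [PowerSeries.coeff_mul, configSeries, PowerSeries.coeff_mk]
  exact Finset.measurable_sum _ fun p _ =>
    ((measurable_configIntegral hφ hW p.1).div_const _).mul_const _

lemma IsActivity.integrable_vertexWeight_mul (hw : IsActivity w) (hβ : 0 ≤ β) (hφ : Measurable φ)
    (y : Pos d) {n : ℕ} {F : (Fin n → Pos d) → ℝ} (hF : Measurable F) {C : ℝ}
    (hC : ∀ u, |F u| ≤ C) :
    Integrable (fun u : Fin n → Pos d => vertexWeight β φ y univ u * (∏ i, w (u i)) * F u) := by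
  have hv : Integrable (fun u : Fin n → Pos d => vertexWeight β φ y univ u * (∏ i, w (u i))) := by
    refine (hw.integrable_prod n).mono' ((measurable_vertexWeight hφ _ measurable_const
      measurable_id).mul (hw.measurable_prod n)).aestronglyMeasurable (ae_of_all _ fun u => ?_)
    rw [Real.norm_of_nonneg (mul_nonneg (vertexWeight_nonneg hβ _ _ _)
      (prod_activity_nonneg hw.nonneg u))]
    refine mul_le_of_le_one_left (prod_activity_nonneg hw.nonneg u) ?_
    exact mul_le_one₀ (prod_le_one (fun _ _ => sub_nonneg.2 (pairWeight_le_one hβ _ _))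
      fun _ _ => sub_le_self _ (pairWeight_nonneg _ _)) (interaction_nonneg _ _)
      (interaction_le_one hβ _ _)
  exact hv.mul_bdd hF.aestronglyMeasurable (ae_of_all _ hC)

end Series

end RepulsiveGas

/-! ### Domination of ratios of partition functions by forest numbers. -/

namespace RepulsiveGas

open MeasureTheory Finset

lemma sum_antidiagonal_assoc {M : Type*} [AddCommMonoid M] (m : ℕ) (f : ℕ → ℕ → ℕ → M) :
    ∑ p ∈ antidiagonal m, ∑ q ∈ antidiagonal p.1, f q.1 q.2 p.2 =
      ∑ p ∈ antidiagonal m, ∑ q ∈ antidiagonal p.2, f p.1 q.1 q.2 := by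
  rw [sum_sigma', sum_sigma']
  refine sum_nbij' (fun x => ⟨(x.2.1, x.2.2 + x.1.2), (x.2.2, x.1.2)⟩)
    (fun x => ⟨(x.1.1 + x.2.1, x.2.2), (x.1.1, x.2.1)⟩) ?_ ?_ ?_ ?_ ?_
  · rintro ⟨⟨a, b⟩, c, e⟩ h
    simp only [mem_sigma, HasAntidiagonal.mem_antidiagonal] at h ⊢
    exact ⟨by omega, trivial⟩
  · rintro ⟨⟨a, b⟩, c, e⟩ h
    simp only [mem_sigma, HasAntidiagonal.mem_antidiagonal] at h ⊢
    exact ⟨by omega, trivial⟩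
  · rintro ⟨⟨a, b⟩, c, e⟩ h
    simp only [mem_sigma, HasAntidiagonal.mem_antidiagonal] at h
    obtain ⟨h1, h2⟩ := h
    subst h2; rfl
  · rintro ⟨⟨a, b⟩, c, e⟩ h
    simp only [mem_sigma, HasAntidiagonal.mem_antidiagonal] at h
    obtain ⟨h1, h2⟩ := h
    subst h2; rfl
  · rintro ⟨⟨a, b⟩, c, e⟩ h
    rfl

section Bounds

variable {d : ℕ} {β : ℝ} {φ : ℝ≥0 → ℝ≥0∞} {w : Pos d → ℝ}

lemma IsActivity.measurable_screened_uncurry (hw : IsActivity w) (hφ : Measurable φ) (n : ℕ) :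
    Measurable (fun p : (Fin n → Pos d) × Pos d => screened β φ w p.1 p.2) :=
  measurable_screened hφ hw.measurable measurable_fst measurable_snd

/-- The Kirkwood-Salsburg identity for the power series of partition functions. -/
lemma IsActivity.coeff_configSeries_screened (hw : IsActivity w) (hβ : 0 ≤ β) (hφ : Measurable φ)
    (y : Pos d) (I : PowerSeries ℝ) (m : ℕ) :
    PowerSeries.coeff m (configSeries β φ (screened β φ w (fun _ : Fin 1 => y)) * I) =
      ∑ n ∈ range (m + 1), (-1) ^ n / n.factorial *
        ∫ u : Fin n → Pos d, vertexWeight β φ y univ u * (∏ i, w (u i)) *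
          PowerSeries.coeff (m - n) (configSeries β φ (screened β φ w u) * I) := by
  -- Division by N! turns the binomial coefficient into 1/(n! (N - n)!), so the identity becomes a
  -- convolution.
  have h1 : ∀ N, configIntegral β φ (screened β φ w (fun _ : Fin 1 => y)) N / N.factorial =
      ∑ q ∈ antidiagonal N, (-1) ^ q.1 / q.1.factorial *
        ∫ u : Fin q.1 → Pos d, vertexWeight β φ y univ u * (∏ i, w (u i)) *
          (configIntegral β φ (screened β φ w u) q.2 / q.2.factorial) := by
    intro N
    rw [hw.configIntegral_screened hβ hφ, sum_div, Nat.sum_antidiagonal_eq_sum_range_succ_mk]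
    refine sum_congr rfl fun n hn => ?_
    have hn' : n ≤ N := Nat.lt_succ_iff.1 (mem_range.1 hn)
    simp only
    simp_rw [← mul_div_assoc]
    rw [integral_div, Nat.cast_choose ℝ hn']
    have := N.factorial_ne_zero
    field_simp
  have hmeas : ∀ n k, Measurable fun u : Fin n → Pos d =>
      configIntegral β φ (screened β φ w u) k / k.factorial := fun n k =>
    (measurable_configIntegral hφ (hw.measurable_screened_uncurry hφ n) k).div_const _
  have hbd : ∀ n k (u : Fin n → Pos d), |configIntegral β φ (screened β φ w u) k / k.factorial| ≤
      (∫ v, w v) ^ k / k.factorial := by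
    intro n k u
    have hs := hw.isActivity_screened hβ hφ u
    rw [abs_of_nonneg (div_nonneg (configIntegral_nonneg hs.nonneg _) (by positivity))]
    gcongr
    refine (hs.configIntegral_le hβ hφ _).trans ?_
    have h0 : 0 ≤ ∫ v, screened β φ w u v := integral_nonneg hs.nonneg
    have h1 : ∫ v, screened β φ w u v ≤ ∫ v, w v :=
      integral_mono hs.integrable hw.integrable (screened_le hβ hw.nonneg u)
    gcongr
  rw [PowerSeries.coeff_mul]
  simp only [configSeries, PowerSeries.coeff_mk, h1, sum_mul]
  rw [sum_antidiagonal_assoc m (fun a b c => (-1) ^ a / (a.factorial : ℝ) *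
        (∫ u : Fin a → Pos d, vertexWeight β φ y univ u * (∏ i, w (u i)) *
          (configIntegral β φ (screened β φ w u) b / b.factorial)) * PowerSeries.coeff c I),
    Nat.sum_antidiagonal_eq_sum_range_succ_mk]
  refine sum_congr rfl fun n _ => ?_
  simp only [PowerSeries.coeff_mul, PowerSeries.coeff_mk, mul_sum]
  rw [integral_finsetSum, mul_sum]
  · refine sum_congr rfl fun q _ => ?_
    simp_rw [← mul_assoc]
    rw [integral_mul_const]
    ring
  · intro q _
    simp_rw [← mul_assoc]
    exact (hw.integrable_vertexWeight_mul hβ hφ y (hmeas n q.1) (hbd n q.1)).mul_const _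

/-- Treats all fixed particles but the first as background, so that the one-particle identity
explores the first. -/
lemma screened_cons (w : Pos d → ℝ) {k : ℕ} (u : Fin (k + 1) → Pos d) :
    screened β φ w u = screened β φ (screened β φ w (Fin.tail u)) (fun _ : Fin 1 => u 0) := by
  ext v
  simp [screened, Fin.prod_univ_succ, Fin.tail]
  ring

/-- After the exploration the new particles `t` join the unexplored ones `u` as roots. -/
lemma screened_append (w : Pos d → ℝ) {k n : ℕ} (t : Fin n → Pos d) (u : Fin k → Pos d) :
    screened β φ w (Fin.append t u) = screened β φ (screened β φ w u) t := by
  ext v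
  simp [screened, Fin.prod_univ_add]
  ring

lemma lintegral_vertexWeight (y : Pos d) (n : ℕ) :
    ∫⁻ u : Fin n → Pos d, ENNReal.ofReal (vertexWeight β φ y univ u) = vertexIntegral d β φ n := by
  have h := lintegral_add_right_eq_self (μ := (volume : Measure (Fin n → Pos d)))
    (fun u : Fin n → Pos d => ENNReal.ofReal (vertexWeight β φ y univ u)) (fun _ => y)
  rw [← h, vertexIntegral]
  refine lintegral_congr fun u => ?_
  have := vertexWeight_add_right (β := β) (φ := φ) 0 y univ u
  rw [zero_add] at this
  rw [← this]; rfl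

/-- The alternating sign and the activities, at most 1, are discarded. The integral of the vertex
weight does not depend on `y` by translation invariance. -/
lemma enorm_vertex_term_le (hβ : 0 ≤ β) (hφ : Measurable φ) (hw : IsActivity w) (y : Pos d)
    {n : ℕ} {F : (Fin n → Pos d) → ℝ} {B : ℝ≥0∞} (hB : ∀ t, ‖F t‖ₑ ≤ B) :
    ‖(-1) ^ n / (n.factorial : ℝ) *
        ∫ t : Fin n → Pos d, vertexWeight β φ y univ t * (∏ i, w (t i)) * F t‖ₑ ≤
      vertexIntegral d β φ n / n.factorial * B := by
  have h1 : ‖(-1 : ℝ) ^ n / (n.factorial : ℝ)‖ₑ = (n.factorial : ℝ≥0∞)⁻¹ := by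
    rw [Real.enorm_eq_ofReal_abs, abs_div, abs_pow, abs_neg, abs_one, one_pow, Nat.abs_cast,
      one_div, ENNReal.ofReal_inv_of_pos (by positivity), ENNReal.ofReal_natCast]
  have h2 : ‖∫ t : Fin n → Pos d, vertexWeight β φ y univ t * (∏ i, w (t i)) * F t‖ₑ ≤
      vertexIntegral d β φ n * B := by
    refine (enorm_integral_le_lintegral_enorm _).trans ?_
    have hm : Measurable fun t : Fin n → Pos d => ENNReal.ofReal (vertexWeight β φ y univ t) :=
      (measurable_vertexWeight hφ _ measurable_const measurable_id).ennreal_ofReal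
    rw [← lintegral_vertexWeight y, ← lintegral_mul_const _ hm]
    refine lintegral_mono fun t => ?_
    rw [enorm_mul]
    gcongr
    · rw [Real.enorm_of_nonneg (mul_nonneg (vertexWeight_nonneg hβ _ _ _)
        (prod_activity_nonneg hw.nonneg t))]
      refine ENNReal.ofReal_le_ofReal (mul_le_of_le_one_right (vertexWeight_nonneg hβ _ _ _) ?_)
      exact prod_le_one (fun _ _ => hw.nonneg _) fun _ _ => hw.le_one _
    · exact hB t
  rw [enorm_mul, h1, div_eq_mul_inv, mul_comm (vertexIntegral d β φ n), mul_assoc]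
  gcongr

/-- The coefficients of the ratio of two partition functions are dominated by forest counts. -/
lemma IsActivity.enorm_coeff_ratio_le (hw : IsActivity w) (hβ : 0 ≤ β) (hφ : Measurable φ) :
    ∀ (k m : ℕ) (u : Fin k → Pos d),
      ‖PowerSeries.coeff m (configSeries β φ (screened β φ w u) * (configSeries β φ w)⁻¹)‖ₑ ≤
        forestCoeff (vertexIntegral d β φ) k m := by
  suffices H : ∀ s k m, k + m = s → ∀ u : Fin k → Pos d,
      ‖PowerSeries.coeff m (configSeries β φ (screened β φ w u) * (configSeries β φ w)⁻¹)‖ₑ ≤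
        forestCoeff (vertexIntegral d β φ) k m from fun k m => H _ k m rfl
  intro s
  induction s using Nat.strong_induction_on with
  | _ s ih =>
  rintro (_ | k) m hs u
  · have : screened β φ w u = w := by ext v; simp [screened]
    rw [this, configSeries_mul_inv, forestCoeff_zero, PowerSeries.coeff_one]
    split_ifs <;> simp
  -- Only the numerator is expanded; the fixed series `(configSeries β φ w)⁻¹` plays the role of
  -- `I`.
  · rw [screened_cons, (hw.isActivity_screened hβ hφ _).coeff_configSeries_screened hβ hφ,
      forestCoeff_succ]
    refine (enorm_sum_le _ _).trans (sum_le_sum fun n hn => ?_)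
    have hn' : n < m + 1 := mem_range.1 hn
    refine enorm_vertex_term_le hβ hφ (hw.isActivity_screened hβ hφ _) _ fun t => ?_
    rw [← screened_append]
    exact ih (n + k + (m - n)) (by omega) _ _ rfl _

end Bounds

end RepulsiveGas

/-! ### The vertex function, supersolutions and fixed points. -/

namespace RepulsiveGas

open MeasureTheory Finset

section VertexSum

variable {d : ℕ} {β : ℝ} {φ : ℝ≥0 → ℝ≥0∞}

/-- The exploration recursion for truncated generating functions, after exchanging the sums over the
order and the number of children. Factors of `r` are distributed so that each new root carries one,
and the truncation shrinks by the number of children. -/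
lemma sum_range_forestCoeff_succ (g : ℕ → ℝ≥0∞) (r : ℝ≥0∞) (k n : ℕ) :
    r ^ k * ∑ m ∈ range n, r ^ m * forestCoeff g (k + 1) m =
      ∑ j ∈ range n, g j / j.factorial *
        (r ^ (j + k) * ∑ i ∈ range (n - j), r ^ i * forestCoeff g (j + k) i) := by
  have h : ∀ m, r ^ m * forestCoeff g (k + 1) m = ∑ j ∈ range (m + 1),
      (fun j i => g j / j.factorial * (r ^ (j + i) * forestCoeff g (j + k) i)) j (m - j) := by
    intro m
    rw [forestCoeff_succ, mul_sum]
    refine sum_congr rfl fun j hj => ?_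
    have : j + (m - j) = m := Nat.add_sub_cancel' (Nat.lt_succ_iff.1 (mem_range.1 hj))
    simp only [this]
    ring
  rw [sum_congr rfl fun m _ => h m, sum_range_diag_flip n fun j i =>
    g j / j.factorial * (r ^ (j + i) * forestCoeff g (j + k) i), mul_sum]
  refine sum_congr rfl fun j _ => ?_
  simp only [mul_sum]
  refine sum_congr rfl fun i _ => ?_
  ring

lemma forestCoeff_lt_top {g : ℕ → ℝ≥0∞} (hg : ∀ n, g n < ⊤) (k m : ℕ) : forestCoeff g k m < ⊤ := by
  suffices H : ∀ s k m, k + m = s → forestCoeff g k m < ⊤ from H _ k m rfl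
  intro s
  induction s using Nat.strong_induction_on with
  | _ s ih =>
  rintro (_ | k) m hs
  · rw [forestCoeff_zero]
    split_ifs <;> simp
  · rw [forestCoeff_succ]
    refine ENNReal.sum_lt_top.2 fun j hj => ENNReal.mul_lt_top
      (ENNReal.div_lt_top (hg j).ne (by simp [Nat.factorial_ne_zero])) ?_
    have := mem_range.1 hj
    exact ih (j + k + (m - j)) (by omega) _ _ rfl

/-- If `y` is a supersolution of the fixed point equation, the generating function of forests with
`k` roots is at most `y ^ k`. -/
lemma sum_range_forestCoeff_le {r y : ℝ≥0∞} (h : r * vertexSum d β φ y ≤ y) (k n : ℕ) :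
    r ^ k * ∑ m ∈ range n, r ^ m * forestCoeff (vertexIntegral d β φ) k m ≤ y ^ k := by
  -- The number of roots plus the truncation length drops by one at each exploration, so finite sums
  -- suffice and convergence is not presupposed.
  suffices H : ∀ s k n, k + n = s →
      r ^ k * ∑ m ∈ range n, r ^ m * forestCoeff (vertexIntegral d β φ) k m ≤ y ^ k from
    H _ k n rfl
  intro s
  induction s using Nat.strong_induction_on with
  | _ s ih =>
  rintro (_ | k) n hs
  · simp only [forestCoeff_zero, pow_zero, one_mul, mul_ite, mul_one, mul_zero]
    rw [sum_ite_eq']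
    split_ifs <;> simp
  · rw [pow_succ', mul_assoc, sum_range_forestCoeff_succ, pow_succ]
    calc r * ∑ j ∈ range n, vertexIntegral d β φ j / j.factorial *
          (r ^ (j + k) * ∑ i ∈ range (n - j),
            r ^ i * forestCoeff (vertexIntegral d β φ) (j + k) i)
        ≤ r * ∑ j ∈ range n, vertexIntegral d β φ j / j.factorial * y ^ (j + k) := by
          gcongr with j hj
          have := mem_range.1 hj
          exact ih (j + k + (n - j)) (by omega) _ _ rfl
      _ = y ^ k * (r * ∑ j ∈ range n, y ^ j / j.factorial * vertexIntegral d β φ j) := by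
          simp only [mul_sum]
          refine sum_congr rfl fun j _ => ?_
          simp only [div_eq_mul_inv]; ring
      _ ≤ y ^ k * (r * vertexSum d β φ y) := by
          gcongr
          exact ENNReal.sum_le_tsum _
      _ ≤ y ^ k * y := by gcongr

/-- Exploring the root separately avoids dividing by `r`, so the bound remains useful for `r = 0`.
-/
lemma tsum_forestCoeff_one_le {r y : ℝ≥0∞} (h : r * vertexSum d β φ y ≤ y) :
    ∑' m, r ^ m * forestCoeff (vertexIntegral d β φ) 1 m ≤ vertexSum d β φ y := by
  refine ENNReal.tsum_le_of_sum_range_le fun n => ?_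
  have h1 := sum_range_forestCoeff_succ (vertexIntegral d β φ) r 0 n
  rw [pow_zero, one_mul] at h1
  rw [h1]
  refine le_trans (sum_le_sum fun j _ => ?_) (ENNReal.sum_le_tsum (range n))
  have := sum_range_forestCoeff_le h (j + 0) (n - j)
  calc _ ≤ vertexIntegral d β φ j / j.factorial * y ^ (j + 0) := by gcongr
    _ = _ := by simp only [div_eq_mul_inv, add_zero]; ring

lemma mul_tsum_forestCoeff_one_le {r y : ℝ≥0∞} (h : r * vertexSum d β φ y ≤ y) :
    r * ∑' m, r ^ m * forestCoeff (vertexIntegral d β φ) 1 m ≤ y :=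
  (mul_le_mul_right (tsum_forestCoeff_one_le h) r).trans h

lemma tempering_eq (hβ : 0 ≤ β) :
    tempering d β φ = ∫⁻ x : Pos d, ENNReal.ofReal (1 - pairWeight β φ 0 x) := by
  refine lintegral_congr fun x => ?_
  rw [abs_sub_comm, abs_of_nonneg (sub_nonneg.2 (pairWeight_le_one hβ _ _)), pairWeight_comm]

lemma integrable_one_sub_pairWeight (hβ : 0 ≤ β) (hφ : Measurable φ)
    (hC : tempering d β φ < ⊤) : Integrable (fun x : Pos d => 1 - pairWeight β φ 0 x) := by
  refine ⟨(measurable_const.sub (measurable_pairWeight_comp hφ measurable_const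
    measurable_id)).aestronglyMeasurable, ?_⟩
  rw [hasFiniteIntegral_iff_ofReal (ae_of_all _ fun x => sub_nonneg.2 (pairWeight_le_one hβ _ _)),
    ← tempering_eq hβ]
  exact hC

/-- Dropping the repulsion among the children makes the integral factorise. It follows that Ψ is
dominated by an exponential series. -/
lemma vertexIntegral_le (hβ : 0 ≤ β) (hφ : Measurable φ) (hC : tempering d β φ < ⊤) (n : ℕ) :
    vertexIntegral d β φ n ≤ tempering d β φ ^ n := by
  have hi := integrable_one_sub_pairWeight hβ hφ hC
  have h0 : ∀ x : Pos d, 0 ≤ 1 - pairWeight β φ 0 x := fun x =>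
    sub_nonneg.2 (pairWeight_le_one hβ _ _)
  have h := integral_fintype_prod_volume_eq_pow (ι := Fin n)
    (fun x : Pos d => 1 - pairWeight β φ 0 x)
  rw [Fintype.card_fin] at h
  calc vertexIntegral d β φ n
      ≤ ∫⁻ x : Fin n → Pos d, ENNReal.ofReal (∏ i, (1 - pairWeight β φ 0 (x i))) :=
        lintegral_mono fun x => ENNReal.ofReal_le_ofReal
          (mul_le_of_le_one_right (prod_nonneg fun _ _ => h0 _) (interaction_le_one hβ _ _))
    _ = ENNReal.ofReal ((∫ x : Pos d, (1 - pairWeight β φ 0 x)) ^ n) := by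
        have hp : Integrable fun x : Fin n → Pos d => ∏ i, (1 - pairWeight β φ 0 (x i)) :=
          Integrable.fintype_prod (f := fun _ x => 1 - pairWeight β φ 0 x) fun _ => hi
        rw [← h, ofReal_integral_eq_lintegral_ofReal hp
          (ae_of_all _ fun x => prod_nonneg fun _ _ => h0 _)]
    _ = tempering d β φ ^ n := by
        rw [ENNReal.ofReal_pow (integral_nonneg h0), ofReal_integral_eq_lintegral_ofReal hi
          (ae_of_all _ h0), ← tempering_eq hβ]

lemma vertexIntegral_one (hβ : 0 ≤ β) : vertexIntegral d β φ 1 = tempering d β φ := by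
  rw [tempering_eq hβ, vertexIntegral]
  have h := (volume_preserving_funUnique (Fin 1) (Pos d)).lintegral_comp_emb
    (MeasurableEquiv.measurableEmbedding _) (fun x => ENNReal.ofReal (1 - pairWeight β φ 0 x))
  rw [← h]
  refine lintegral_congr fun u => ?_
  simp [vertexWeight_eq, interaction_eq, MeasurableEquiv.funUnique]

lemma vertexSum_mono : Monotone (vertexSum d β φ) := fun x y h => by
  unfold vertexSum
  gcongr

lemma vertexSum_lt_top (hβ : 0 ≤ β) (hφ : Measurable φ) (hC : tempering d β φ < ⊤) {x : ℝ≥0∞}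
    (hx : x < ⊤) : vertexSum d β φ x < ⊤ := by
  have hlt : x * tempering d β φ < ⊤ := ENNReal.mul_lt_top hx hC
  set a := (x * tempering d β φ).toReal with ha
  have ha' : ENNReal.ofReal a = x * tempering d β φ := ENNReal.ofReal_toReal hlt.ne
  have h0 : 0 ≤ a := ENNReal.toReal_nonneg
  calc vertexSum d β φ x ≤ ∑' n : ℕ, ENNReal.ofReal (a ^ n / n.factorial) := by
        refine ENNReal.tsum_le_tsum fun n => ?_
        rw [ENNReal.ofReal_div_of_pos (by positivity), ENNReal.ofReal_pow h0, ha', mul_pow,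
          ENNReal.ofReal_natCast, ENNReal.mul_div_right_comm]
        gcongr
        exact vertexIntegral_le hβ hφ hC n
    _ < ⊤ := by
        rw [← ENNReal.ofReal_tsum_of_nonneg (fun n => by positivity)
          (Real.summable_pow_div_factorial a)]
        exact ENNReal.ofReal_lt_top

/-- The linear term has coefficient C(β) > 0 and is strictly increasing; the other terms are
monotone. -/
lemma vertexSum_strictMono (hβ : 0 ≤ β) (hφ : Measurable φ) (hC : tempering d β φ < ⊤)
    (hC0 : tempering d β φ ≠ 0) {x y : ℝ≥0∞} (hxy : x < y) :
    vertexSum d β φ x < vertexSum d β φ y := by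
  refine ENNReal.tsum_lt_tsum (i := 1) (vertexSum_lt_top hβ hφ hC (hxy.trans_le le_top)).ne
    (fun n => by gcongr) ?_
  simp only [pow_one, Nat.factorial_one, Nat.cast_one, div_one, vertexIntegral_one hβ]
  exact ENNReal.mul_lt_mul_left hC0 hC.ne hxy

/-- Dominated convergence for the counting measure, with the convergent series at `x 0` as majorant.
-/
lemma tendsto_vertexSum (hβ : 0 ≤ β) (hφ : Measurable φ) (hC : tempering d β φ < ⊤)
    {x : ℕ → ℝ≥0∞} (hx : Antitone x) (h0 : x 0 < ⊤) {L : ℝ≥0∞}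
    (hL : Filter.Tendsto x Filter.atTop (nhds L)) :
    Filter.Tendsto (fun n => vertexSum d β φ (x n)) Filter.atTop (nhds (vertexSum d β φ L)) := by
  simp only [vertexSum, ← lintegral_count]
  refine tendsto_lintegral_of_dominated_convergence
    (fun n => (x 0) ^ n / n.factorial * vertexIntegral d β φ n) (fun n => measurable_of_countable _)
    (fun k => ae_of_all _ fun n => ?_) ?_ (ae_of_all _ fun n => ?_)
  · have := hx (Nat.zero_le k)
    simp only
    gcongr
  · rw [lintegral_count]
    exact (vertexSum_lt_top hβ hφ hC h0).ne
  · simp only [div_eq_mul_inv, mul_assoc]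
    refine ENNReal.Tendsto.mul_const (ENNReal.Tendsto.pow hL) (Or.inr ?_)
    refine ENNReal.mul_ne_top (by simp [Nat.factorial_ne_zero]) ?_
    exact ((vertexIntegral_le hβ hφ hC n).trans_lt (ENNReal.pow_lt_top hC)).ne

lemma vertexMap_mono (z : ℂ) : Monotone (vertexMap d β φ z) := fun x y h => by
  unfold vertexMap
  gcongr
  exact vertexSum_mono h

lemma vertexMap_lt_top (hβ : 0 ≤ β) (hφ : Measurable φ) (hC : tempering d β φ < ⊤) (z : ℂ)
    {x : ℝ≥0∞} (hx : x < ⊤) : vertexMap d β φ z x < ⊤ :=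
  ENNReal.mul_lt_top enorm_lt_top (vertexSum_lt_top hβ hφ hC hx)

lemma vertexMap_strictMono (hβ : 0 ≤ β) (hφ : Measurable φ) (hC : tempering d β φ < ⊤)
    (hC0 : tempering d β φ ≠ 0) {z : ℂ} (hz : z ≠ 0) : StrictMono (vertexMap d β φ z) :=
  fun _ _ h => ENNReal.mul_lt_mul_right (by simpa using hz) enorm_ne_top
    (vertexSum_strictMono hβ hφ hC hC0 h)

lemma vertexMap_le_of_le_div {z : ℂ} {x : ℝ≥0∞} (h : ‖z‖ₑ ≤ x / vertexSum d β φ x) :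
    vertexMap d β φ z x ≤ x :=
  ENNReal.mul_le_of_le_div h

lemma vertexMap_lt_of_lt_div {z : ℂ} {x : ℝ≥0∞} (h : ‖z‖ₑ < x / vertexSum d β φ x) :
    vertexMap d β φ z x < x :=
  ENNReal.mul_lt_of_lt_div h

/-- The iterates of the vertex map from a supersolution converge to a fixed point. -/
lemma tendsto_iterate_vertexMap (hβ : 0 ≤ β) (hφ : Measurable φ) (hC : tempering d β φ < ⊤)
    {z : ℂ} {x : ℝ≥0∞} (hx : x < ⊤) (h : vertexMap d β φ z x ≤ x) :
    ∃ L : ℝ≥0∞, Filter.Tendsto (fun n : ℕ => (vertexMap d β φ z)^[n] x) Filter.atTop (nhds L) ∧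
      vertexMap d β φ z L = L ∧ ∀ n : ℕ, L ≤ (vertexMap d β φ z)^[n] x := by
  have ha : Antitone fun n : ℕ => (vertexMap d β φ z)^[n] x :=
    (vertexMap_mono z).antitone_iterate_of_map_le h
  have hL := tendsto_atTop_iInf ha
  refine ⟨_, hL, ?_, fun n => iInf_le _ n⟩
  have h1 := ENNReal.Tendsto.const_mul (tendsto_vertexSum hβ hφ hC ha hx hL) (a := ‖z‖ₑ)
    (Or.inr enorm_ne_top)
  -- The images of the iterates are the shifted iterates, so both limits agree.
  refine tendsto_nhds_unique (h1.congr fun n => ?_) (hL.comp (Filter.tendsto_add_atTop_nat 1))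
  simp only [Function.comp, Function.iterate_succ_apply', vertexMap]

end VertexSum

end RepulsiveGas

/-! ### Forests encoded by parent functions. -/

namespace RepulsiveGas

open MeasureTheory Finset

section Forests

variable {V : Type*}

/-- The iterates of the parent function `p` lead from `v` into `S`. -/
inductive Reaches (p : V → V) (S : Finset V) : V → Prop
  | base {v : V} : v ∈ S → Reaches p S v
  | step {v : V} : Reaches p S (p v) → Reaches p S v

/-- `p` is the parent function of a forest with roots `S` and further vertices `U`. -/
def IsForest (S U : Finset V) (p : V → V) : Prop :=
  -- Roots and unused vertices are fixed by convention, so that each forest corresponds to exactly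
  -- one function.
  (∀ v ∉ U, p v = v) ∧ ∀ v ∈ U, Reaches p S v

open scoped Classical in
/-- The sum over forests with roots `S` and further vertices `U` of the products over the vertices
`i` of weights `W i C`, where `C` is the set of the children of `i`. -/
noncomputable def forestSum [Fintype V] [DecidableEq V] {M : Type*} [CommSemiring M] (W : V → Finset V → M)
    (S U : Finset V) : M :=
  ∑ p : V → V with IsForest S U p, ∏ i ∈ S ∪ U, W i {j ∈ U | p j = i}

lemma not_reaches_empty (p : V → V) (v : V) : ¬ Reaches p ∅ v := by
  intro h
  induction h with
  | base h => simp at h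
  | step _ ih => exact ih

lemma not_reaches_of_fixed {p : V → V} {S : Finset V} {s : V} (hs : s ∉ S) (hp : p s = s) :
    ¬ Reaches p S s := by
  suffices H : ∀ v, Reaches p S v → v ≠ s from fun h => H s h rfl
  intro v h
  induction h with
  | base h => exact fun e => hs (e ▸ h)
  | step _ ih => exact fun e => ih (by rw [e, hp])

variable [DecidableEq V]

/-- Deleting the explored root `s` promotes its children to roots. A path of parents ending in `s`
passes through such a child unless it starts at `s`, so every remaining vertex still reaches a root.
-/
lemma IsForest.explore {S U : Finset V} {p : V → V} (h : IsForest S U p) {s : V} (hs : s ∉ U) :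
    IsForest (S.erase s ∪ {j ∈ U | p j = s}) (U \ {j ∈ U | p j = s})
      (fun j => if j ∈ ({j ∈ U | p j = s} : Finset V) then j else p j) := by
  set C : Finset V := {j ∈ U | p j = s}
  set q : V → V := fun j => if j ∈ C then j else p j with hq
  refine ⟨fun v hv => ?_, fun v hv => ?_⟩
  · by_cases hc : v ∈ C
    · simp [hq, hc]
    · have : v ∉ U := fun hu => hv (mem_sdiff.2 ⟨hu, hc⟩)
      simp [hq, hc, h.1 v this]
  · have key : ∀ v, Reaches p S v → v = s ∨ Reaches q (S.erase s ∪ C) v := by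
      intro v hr
      induction hr with
      | @base v hv =>
        by_cases e : v = s
        · exact Or.inl e
        · exact Or.inr (.base (mem_union_left _ (mem_erase.2 ⟨e, hv⟩)))
      | @step v _ ih =>
        by_cases hc : v ∈ C
        · exact Or.inr (.base (mem_union_right _ hc))
        by_cases hu : v ∈ U
        · have hne : p v ≠ s := fun e => hc (mem_filter.2 ⟨hu, e⟩)
          refine Or.inr (.step ?_)
          simpa [hq, hc] using ih.resolve_left hne
        · rwa [h.1 v hu] at ih
    rcases mem_sdiff.1 hv with ⟨hu, hc⟩
    have hne : p v ≠ s := fun e => hc (mem_filter.2 ⟨hu, e⟩)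
    exact (key v (h.2 v hu)).resolve_left fun e => hs (e ▸ hu)

/-- The inverse of the exploration: paths that ended in `C` are prolonged by one step to `s`. -/
lemma IsForest.attach {S U C : Finset V} {s : V} (hs : s ∈ S) (hC : C ⊆ U) {q : V → V}
    (h : IsForest (S.erase s ∪ C) (U \ C) q) : IsForest S U (fun j => if j ∈ C then s else q j) := by
  set p : V → V := fun j => if j ∈ C then s else q j with hp
  have hCr : ∀ v ∈ C, Reaches p S v := fun v hv => .step (by simpa [hp, hv] using .base hs)
  have key : ∀ v, Reaches q (S.erase s ∪ C) v → Reaches p S v := by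
    intro v hr
    induction hr with
    | base hv =>
      rcases mem_union.1 hv with hv | hv
      · exact .base (mem_of_mem_erase hv)
      · exact hCr _ hv
    | @step v _ ih =>
      by_cases hc : v ∈ C
      · exact hCr _ hc
      · exact .step (by simpa [hp, hc] using ih)
  refine ⟨fun v hv => ?_, fun v hv => ?_⟩
  · have hc : v ∉ C := fun hc => hv (hC hc)
    simp [hp, hc, h.1 v (fun hu => hv (mem_sdiff.1 hu).1)]
  · by_cases hc : v ∈ C
    · exact hCr _ hc
    · exact key v (h.2 v (mem_sdiff.2 ⟨hv, hc⟩))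

variable [Fintype V] {M : Type*} [CommSemiring M] (W : V → Finset V → M)

open scoped Classical in
lemma forestSum_empty (U : Finset V) : forestSum W ∅ U = if U = ∅ then 1 else 0 := by
  unfold forestSum
  split_ifs with h
  · subst h
    have : ({p : V → V | IsForest ∅ ∅ p} : Finset (V → V)) = {id} := by
      ext p
      simp [IsForest, funext_iff]
    rw [this]; simp
  · obtain ⟨v, hv⟩ := nonempty_iff_ne_empty.2 h
    refine sum_eq_zero fun p hp => ?_
    exact absurd ((mem_filter.1 hp).2.2 v hv) (not_reaches_empty p v)

open scoped Classical in
/-- The exploration of the children of one root of a forest. -/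
lemma forestSum_explore {S U : Finset V} (hSU : Disjoint S U) {s : V} (hs : s ∈ S) :
    forestSum W S U = ∑ C ∈ U.powerset, W s C * forestSum W (S.erase s ∪ C) (U \ C) := by
  have hsU : s ∉ U := disjoint_left.1 hSU hs
  unfold forestSum
  -- Forests are sorted by the set of children of `s`; within a fibre, `explore` and `attach` are
  -- mutually inverse.
  rw [← sum_fiberwise_of_maps_to (g := fun p => ({j ∈ U | p j = s} : Finset V))
    (t := U.powerset) (fun p _ => mem_powerset.2 (filter_subset _ _))]
  refine sum_congr rfl fun C hC => ?_
  have hC := mem_powerset.1 hC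
  rw [mul_sum]
  refine sum_nbij' (fun p j => if j ∈ C then j else p j) (fun q j => if j ∈ C then s else q j)
    ?_ ?_ ?_ ?_ ?_
  · intro p hp
    simp only [mem_filter, mem_univ, true_and] at hp ⊢
    obtain ⟨hp, e⟩ := hp
    have := hp.explore hsU
    rw [e] at this
    exact this
  · intro q hq
    simp only [mem_filter, mem_univ, true_and] at hq ⊢
    refine ⟨hq.attach hs hC, ?_⟩
    ext j
    simp only [mem_filter]
    constructor
    · rintro ⟨hj, h⟩
      by_contra hc
      simp only [hc, if_false] at h
      have hr := hq.2 j (mem_sdiff.2 ⟨hj, hc⟩)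
      have hjS : j ∉ S := fun h => disjoint_left.1 hSU h hj
      -- If `j ∉ C` had parent `s` under `q`, its path would stop at `s`, which `q` fixes and which
      -- is not among the new roots.
      cases hr with
      | base hb => simp [hjS, hc] at hb
      | step hr =>
        rw [h] at hr
        refine not_reaches_of_fixed ?_ (hq.1 s (by simp [hsU])) hr
        simp only [mem_union, mem_erase, ne_eq, not_true_eq_false, false_and, false_or]
        exact fun h => hsU (hC h)
    · intro hj
      simp [hC hj, hj]
  · intro p hp
    simp only [mem_filter, mem_univ, true_and] at hp
    obtain ⟨hp, e⟩ := hp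
    ext j
    by_cases hj : j ∈ C
    · have : j ∈ ({j ∈ U | p j = s} : Finset V) := e ▸ hj
      simp [hj, (mem_filter.1 this).2]
    · simp [hj]
  · intro q hq
    simp only [mem_filter, mem_univ, true_and] at hq
    ext j
    by_cases hj : j ∈ C
    · simp [hj, hq.1 j (fun h => (mem_sdiff.1 h).2 hj)]
    · simp [hj]
  · intro p hp
    simp only [mem_filter, mem_univ, true_and] at hp
    obtain ⟨hp, e⟩ := hp
    have e2 : S ∪ U = insert s ((S.erase s ∪ C) ∪ (U \ C)) := by
      rw [union_assoc, union_sdiff_of_subset hC, ← insert_union, insert_erase hs]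
    have e3 : s ∉ (S.erase s ∪ C) ∪ (U \ C) := by
      rw [union_assoc, union_sdiff_of_subset hC]
      simp [hsU]
    rw [e2, prod_insert e3, e]
    congr 1
    refine prod_congr rfl fun i hi => ?_
    congr 1
    have his : i ≠ s := fun h => e3 (h ▸ hi)
    ext j
    by_cases hj : j ∈ C
    · have : j ∈ ({j ∈ U | p j = s} : Finset V) := e ▸ hj
      simp [hj, (mem_filter.1 this).2, his.symm]
    · simp [hj]

end Forests

end RepulsiveGas

/-! ### Rooted trees as parent functions. -/

namespace RepulsiveGas

open MeasureTheory Finset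

section Trees

variable {n : ℕ} {p : Fin (n + 1) → Fin (n + 1)}

/-- The graph whose edges join the vertices to their parents. -/
def parentGraph (p : Fin (n + 1) → Fin (n + 1)) : SimpleGraph (Fin (n + 1)) :=
  SimpleGraph.fromRel fun i j => p j = i

lemma parentGraph_adj {i j : Fin (n + 1)} :
    (parentGraph p).Adj i j ↔ i ≠ j ∧ (p j = i ∨ p i = j) := SimpleGraph.fromRel_adj _ _ _

/-- The level of a vertex is the least number of parent steps to the root. It rules out cycles and
turns out to be the graph distance. -/
lemma IsForest.exists_level (h : IsForest {0} (univ.erase 0) p) :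
    ∃ l : Fin (n + 1) → ℕ, l 0 = 0 ∧ ∀ j, j ≠ 0 → l j = l (p j) + 1 := by
  have hk : ∀ j, Reaches p {0} j → ∃ k, p^[k] j = 0 := by
    intro j hj
    induction hj with
    | base hv => exact ⟨0, by simpa using hv⟩
    | step _ ih =>
      obtain ⟨k, hk⟩ := ih
      exact ⟨k + 1, by simpa using hk⟩
  have hk' : ∀ j, ∃ k, p^[k] j = 0 := fun j => by
    by_cases e : j = 0
    · exact ⟨0, e⟩
    · exact hk j (h.2 j (mem_erase.2 ⟨e, mem_univ _⟩))
  classical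
  refine ⟨fun j => Nat.find (hk' j), by simp, fun j hj => ?_⟩
  exact Nat.find_comp_succ (hk' j) (hk' (p j)) hj

lemma IsForest.ne_parent (h : IsForest {0} (univ.erase 0) p) {j : Fin (n + 1)} (hj : j ≠ 0) :
    p j ≠ j := by
  obtain ⟨l, -, hl⟩ := h.exists_level
  intro e
  have := hl j hj
  rw [e] at this
  omega

lemma IsForest.adj_parent (h : IsForest {0} (univ.erase 0) p) {j : Fin (n + 1)} (hj : j ≠ 0) :
    (parentGraph p).Adj (p j) j :=
  parentGraph_adj.2 ⟨h.ne_parent hj, Or.inl rfl⟩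

lemma IsForest.parent_root (h : IsForest {0} (univ.erase 0) p) : p 0 = 0 := h.1 0 (by simp)

lemma IsForest.connected (h : IsForest {0} (univ.erase 0) p) : (parentGraph p).Connected := by
  have key : ∀ j, Reaches p {0} j → (parentGraph p).Reachable 0 j := by
    intro j hj
    induction hj with
    | base hv => rw [mem_singleton.1 hv]
    | @step v _ ih =>
      by_cases e : v = 0
      · rw [e]
      · exact ih.trans (h.adj_parent e).reachable
  have key' : ∀ j, (parentGraph p).Reachable 0 j := fun j => by
    by_cases e : j = 0
    · rw [e]
    · exact key j (h.2 j (mem_erase.2 ⟨e, mem_univ _⟩))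
  exact ⟨fun i j => (key' i).symm.trans (key' j)⟩

/-- Every edge joins a non-root vertex to its parent, so there are at most `n` edges, and a
connected graph on `n + 1` vertices with that few edges is a tree. -/
lemma IsForest.isTree (h : IsForest {0} (univ.erase 0) p) : (parentGraph p).IsTree := by
  classical
  rw [SimpleGraph.isTree_iff_connected_and_card]
  refine ⟨h.connected, le_antisymm ?_ h.connected.card_vert_le_card_edgeSet_add_one⟩
  have hsub : (parentGraph p).edgeSet ⊆
      ((univ.erase 0).image fun j => s(p j, j) : Finset (Sym2 (Fin (n + 1)))) := by
    intro e
    induction e with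
    | _ a b =>
      intro hab
      rw [SimpleGraph.mem_edgeSet, parentGraph_adj] at hab
      simp only [coe_image, Set.mem_image, mem_coe, mem_erase, mem_univ, and_true]
      obtain ⟨hne, hp | hp⟩ := hab
      · exact ⟨b, fun e => hne (by rw [← hp, e, h.parent_root]), by rw [hp]⟩
      · exact ⟨a, fun e => hne (by rw [← hp, e, h.parent_root]), by rw [hp, Sym2.eq_swap]⟩
  have hc : Nat.card (parentGraph p).edgeSet ≤ n := by
    calc Nat.card (parentGraph p).edgeSet = (parentGraph p).edgeSet.ncard := rfl
      _ ≤ ((univ.erase 0).image fun j => s(p j, j) : Finset (Sym2 (Fin (n + 1)))).card := by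
        rw [← Set.ncard_coe_finset]
        exact Set.ncard_le_ncard hsub (finite_toSet _)
      _ ≤ #(univ.erase (0 : Fin (n + 1))) := card_image_le
      _ = n := by simp
  simpa using hc

/-- The distance to the root equals the level: an edge changes the level by at most one, which
bounds the distance below, and following parents bounds it above. -/
lemma IsForest.dist_eq (h : IsForest {0} (univ.erase 0) p) {j : Fin (n + 1)} (hj : j ≠ 0) :
    (parentGraph p).dist 0 j = (parentGraph p).dist 0 (p j) + 1 := by
  obtain ⟨l, hl0, hl⟩ := h.exists_level
  have hadj : ∀ a b, (parentGraph p).Adj a b → l b ≤ l a + 1 := by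
    intro a b hab
    obtain ⟨hne, hp | hp⟩ := parentGraph_adj.1 hab
    · rw [hl b (fun e => hne (by rw [← hp, e, h.parent_root])), hp]
    · rw [hl a (fun e => hne (by rw [← hp, e, h.parent_root])), hp]
      omega
  have hwalk : ∀ a b (w : (parentGraph p).Walk a b), l b ≤ l a + w.length := by
    intro a b w
    induction w with
    | nil => simp
    | cons hab _ ih =>
      have := hadj _ _ hab
      rw [SimpleGraph.Walk.length_cons]
      omega
  have hge : ∀ j, l j ≤ (parentGraph p).dist 0 j := fun j => by
    obtain ⟨w, hw⟩ := h.connected.exists_walk_length_eq_dist 0 j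
    have := hwalk 0 j w
    omega
  have hle : ∀ k j, l j = k → (parentGraph p).dist 0 j ≤ k := by
    intro k
    induction k with
    | zero =>
      intro j hk
      by_cases e : j = 0
      · simp [e]
      · have := hl j e; omega
    | succ k ih =>
      intro j hk
      have e : j ≠ 0 := fun e => by rw [e, hl0] at hk; omega
      have h1 := ih (p j) (by have := hl j e; omega)
      have h2 := h.connected.dist_triangle (u := 0) (v := p j) (w := j)
      rw [SimpleGraph.dist_eq_one_iff_adj.2 (h.adj_parent e)] at h2
      omega
  have heq : ∀ j, (parentGraph p).dist 0 j = l j := fun j => le_antisymm (hle _ j rfl) (hge j)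
  rw [heq, heq, hl j hj]

open scoped Classical in
lemma IsForest.children_eq (h : IsForest {0} (univ.erase 0) p) (i : Fin (n + 1)) :
    children (parentGraph p) i = (univ.erase (0 : Fin (n + 1))).filter (fun j => p j = i) := by
  ext j
  simp only [children, mem_filter, mem_univ, true_and, mem_erase, and_true]
  constructor
  · rintro ⟨hadj, hd⟩
    have hj : j ≠ 0 := fun e => by rw [e] at hd; simp at hd
    refine ⟨hj, ?_⟩
    obtain ⟨hne, hp | hp⟩ := parentGraph_adj.1 hadj
    · exact hp
    · have hi : i ≠ 0 := fun e => hne (by rw [← hp, e, h.parent_root])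
      have := h.dist_eq hi
      rw [hp] at this
      omega
  · rintro ⟨hj, rfl⟩
    exact ⟨h.adj_parent hj, h.dist_eq hj⟩

/-- Let the parent be the next vertex on a shortest path to the root. The parent graph is then a
connected subgraph of `τ`, and trees are minimal among connected graphs. -/
lemma exists_parentGraph_eq {τ : SimpleGraph (Fin (n + 1))} (hτ : τ.IsTree) :
    ∃ p, IsForest {0} (univ.erase 0) p ∧ parentGraph p = τ := by
  have hconn := hτ.connected
  have hex : ∀ j, ∃ i, (j = 0 → i = 0) ∧ (j ≠ 0 → τ.Adj i j ∧ τ.dist 0 i + 1 = τ.dist 0 j) := by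
    intro j
    by_cases e : j = 0
    · exact ⟨0, fun _ => rfl, fun h => absurd e h⟩
    obtain ⟨w, hw⟩ := hconn.exists_walk_length_eq_dist j 0
    cases w with
    | nil => exact absurd rfl e
    | @cons _ i _ hadj w =>
      refine ⟨i, fun h => absurd h e, fun _ => ⟨hadj.symm, ?_⟩⟩
      rw [SimpleGraph.Walk.length_cons] at hw
      have h1 := SimpleGraph.dist_le w
      have h2 := hconn.dist_triangle (u := 0) (v := i) (w := j)
      rw [SimpleGraph.dist_eq_one_iff_adj.2 hadj.symm] at h2
      rw [SimpleGraph.dist_comm] at hw h1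
      omega
  choose p hp0 hp using hex
  have hf : IsForest {0} (univ.erase 0) p := by
    refine ⟨fun v hv => ?_, fun v _ => ?_⟩
    · have : v = 0 := by simpa using hv
      rw [hp0 v this, this]
    · have : ∀ k v, τ.dist 0 v = k → Reaches p {0} v := by
        intro k
        induction k with
        | zero =>
          intro v hv
          exact .base (mem_singleton.2 ((hconn.dist_eq_zero_iff.1 hv).symm))
        | succ k ih =>
          intro v hv
          have e : v ≠ 0 := fun e => by rw [e] at hv; simp at hv
          have := (hp v e).2
          exact .step (ih _ (by omega))
      exact this _ v rfl
  refine ⟨p, hf, ?_⟩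
  have hle : parentGraph p ≤ τ := by
    intro a b hab
    obtain ⟨hne, h | h⟩ := parentGraph_adj.1 hab
    · have e : b ≠ 0 := fun e => hne (by rw [← h, hp0 b e, e])
      rw [← h]; exact (hp b e).1
    · have e : a ≠ 0 := fun e => hne (by rw [← h, hp0 a e, e])
      rw [← h]; exact (hp a e).1.symm
  exact le_antisymm hle ((SimpleGraph.isTree_iff_minimal_connected.1 hτ).2 hf.connected hle)

open scoped Classical in
/-- Sums over rooted trees are sums over parent functions. -/
lemma sum_isTree_eq_forestSum {M : Type*} [CommSemiring M]
    (W : Fin (n + 1) → Finset (Fin (n + 1)) → M) :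
    ∑ τ : SimpleGraph (Fin (n + 1)) with τ.IsTree, ∏ i, W i (children τ i) =
      forestSum W {0} (univ.erase 0) := by
  symm
  refine sum_bij (fun p _ => parentGraph p) ?_ ?_ ?_ ?_
  · intro p hp
    simpa using (mem_filter.1 hp).2.isTree
  · intro p hp q hq e
    have hp := (mem_filter.1 hp).2
    have hq := (mem_filter.1 hq).2
    ext1 j
    by_cases hj : j = 0
    · rw [hj, hp.parent_root, hq.parent_root]
    -- The parent function is recovered from the graph: `p j` is the vertex that has `j` as a child.
    · have h1 : j ∈ children (parentGraph p) (p j) := by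
        rw [hp.children_eq]; simp [hj]
      rw [e, hq.children_eq] at h1
      exact ((mem_filter.1 h1).2).symm
  · intro τ hτ
    obtain ⟨p, hp, e⟩ := exists_parentGraph_eq (by simpa using hτ : τ.IsTree)
    exact ⟨p, by simpa using hp, e⟩
  · intro p hp
    have hp := (mem_filter.1 hp).2
    have : ({0} : Finset (Fin (n + 1))) ∪ univ.erase 0 = univ := by
      ext i; by_cases e : i = 0 <;> simp [e]
    rw [this]
    refine prod_congr rfl fun i _ => ?_
    rw [hp.children_eq]

end Trees

end RepulsiveGas

/-! ### Integration of tree weights. -/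

namespace RepulsiveGas

open MeasureTheory Finset

section TreeIntegral

variable {d : ℕ} {β : ℝ} {φ : ℝ≥0 → ℝ≥0∞} {N : ℕ}

/-- Marginals keep one ambient configuration while vertices are integrated out in stages; this
translates them back into integrals over `Fin k → Pos d`. -/
lemma lmarginal_eq_lintegral_equiv {k : ℕ} {C : Finset (Fin N)} (e : Fin k ≃ C)
    (F : (Fin N → Pos d) → ℝ≥0∞) (x : Fin N → Pos d) :
    (∫⋯∫⁻_C, F ∂fun _ => volume) x =
      ∫⁻ u : Fin k → Pos d, F (Function.updateFinset x C (u ∘ e.symm)) := by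
  have h := (volume_measurePreserving_piCongrLeft (fun _ : C => Pos d) e).lintegral_comp_emb
    (MeasurableEquiv.measurableEmbedding _) (fun y => F (Function.updateFinset x C y))
  rw [lmarginal, ← volume_pi, ← h]
  refine lintegral_congr fun u => ?_
  congr 2
  ext1 c
  obtain ⟨i, rfl⟩ := e.surjective c
  rw [MeasurableEquiv.piCongrLeft, MeasurableEquiv.coe_mk, Equiv.piCongrLeft_apply_apply]
  simp

/-- The weight of a vertex with given children, as an extended nonnegative real. -/
noncomputable def forestWeight (β : ℝ) (φ : ℝ≥0 → ℝ≥0∞) (x : Fin N → Pos d) (i : Fin N)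
    (C : Finset (Fin N)) : ℝ≥0∞ :=
  ENNReal.ofReal (vertexWeight β φ (x i) C x)

lemma measurable_forestWeight (hφ : Measurable φ) (i : Fin N) (C : Finset (Fin N)) :
    Measurable (fun x : Fin N → Pos d => forestWeight β φ x i C) :=
  (measurable_vertexWeight hφ C (measurable_pi_apply i) measurable_id).ennreal_ofReal

lemma measurable_forestSum (hφ : Measurable φ) (S U : Finset (Fin N)) :
    Measurable (fun x : Fin N → Pos d => forestSum (forestWeight β φ x) S U) :=
  Finset.measurable_sum _ fun _ _ => Finset.measurable_prod _ fun _ _ =>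
    measurable_forestWeight hφ _ _

lemma vertexWeight_congr {m : ℕ} {y : Pos d} {s : Finset (Fin m)} {x x' : Fin m → Pos d}
    (h : ∀ i ∈ s, x i = x' i) : vertexWeight β φ y s x = vertexWeight β φ y s x' := by
  rw [vertexWeight_eq, vertexWeight_eq, interaction_eq, interaction_eq]
  congr 1
  · exact prod_congr rfl fun i hi => by rw [h i hi]
  · exact prod_congr rfl fun i hi => prod_congr rfl fun j hj => by rw [h i hi, h j hj]

lemma lmarginal_forestWeight {s : Fin N} {C : Finset (Fin N)} (hs : s ∉ C) (x : Fin N → Pos d) :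
    (∫⋯∫⁻_C, (fun x => forestWeight β φ x s C) ∂fun _ => volume) x =
      vertexIntegral d β φ #C := by
  rw [lmarginal_eq_lintegral_equiv (C.orderIsoOfFin rfl).toEquiv, ← lintegral_vertexWeight (x s)]
  refine lintegral_congr fun u => ?_
  rw [forestWeight, ← vertexWeight_orderEmbOfFin _ C rfl]
  congr 2
  · simp [Function.updateFinset, hs]
  · ext1 i
    have : C.orderEmbOfFin rfl i ∈ C := orderEmbOfFin_mem _ _ _
    simp only [Function.comp, Function.updateFinset, this, dif_pos]
    congr 1
    exact (C.orderIsoOfFin rfl).symm_apply_apply i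

/-- The integral over the positions of the vertices which are not roots. -/
lemma lmarginal_forestSum (hφ : Measurable φ) {S U : Finset (Fin N)} (hSU : Disjoint S U)
    (x : Fin N → Pos d) :
    (∫⋯∫⁻_U, (fun x => forestSum (forestWeight β φ x) S U) ∂fun _ => volume) x =
      (#U).factorial * forestCoeff (vertexIntegral d β φ) #S #U := by
  suffices H : ∀ t (S U : Finset (Fin N)), Disjoint S U → #S + #U = t → ∀ x : Fin N → Pos d,
      (∫⋯∫⁻_U, (fun x => forestSum (forestWeight β φ x) S U) ∂fun _ => volume) x =
        (#U).factorial * forestCoeff (vertexIntegral d β φ) #S #U from H _ S U hSU rfl x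
  intro t
  induction t using Nat.strong_induction_on with
  | _ t ih =>
  intro S U hSU ht x
  rcases S.eq_empty_or_nonempty with rfl | ⟨s, hs⟩
  · simp only [forestSum_empty, card_empty, forestCoeff_zero]
    by_cases hU : U = ∅
    · subst hU; simp
    · simp [hU, lmarginal]
  have hsU : s ∉ U := disjoint_left.1 hSU hs
  have hS : #S = #S - 1 + 1 := by have := card_pos.2 ⟨s, hs⟩; omega
  have hterm : ∀ C ∈ U.powerset, (∫⋯∫⁻_U, (fun x => forestWeight β φ x s C *
      forestSum (forestWeight β φ x) (S.erase s ∪ C) (U \ C)) ∂fun _ => volume) x =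
      (fun j => vertexIntegral d β φ j * ((#U - j).factorial *
        forestCoeff (vertexIntegral d β φ) (j + (#S - 1)) (#U - j))) #C := by
    intro C hC
    have hC := mem_powerset.1 hC
    have hUC : U = C ∪ (U \ C) := (union_sdiff_of_subset hC).symm
    have hdis : Disjoint C (U \ C) := disjoint_sdiff
    have hcard : #(S.erase s ∪ C) = #C + (#S - 1) := by
      rw [card_union_of_disjoint, card_erase_of_mem hs, add_comm]
      exact (hSU.mono_left (erase_subset _ _)).mono_right hC
    have hcard' : #(U \ C) = #U - #C := card_sdiff_of_subset hC
    -- The non-children are integrated first. The weight of `s` does not involve their positions,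
    -- and the remaining forest integrates to a constant whatever the positions of its roots.
    have hinner : (∫⋯∫⁻_(U \ C), (fun x : Fin N → Pos d => forestWeight β φ x s C *
        forestSum (forestWeight β φ x) (S.erase s ∪ C) (U \ C)) ∂fun _ => volume) =
        fun x : Fin N → Pos d => forestWeight β φ x s C * ((#U - #C).factorial *
          forestCoeff (vertexIntegral d β φ) (#C + (#S - 1)) (#U - #C)) := by
      ext1 x
      have hlt : #(S.erase s ∪ C) + #(U \ C) < t := by
        have := card_le_card hC
        omega
      have hd : Disjoint (S.erase s ∪ C) (U \ C) := by
        rw [disjoint_union_left]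
        exact ⟨(hSU.mono_left (erase_subset _ _)).mono_right sdiff_subset, hdis⟩
      have := ih _ hlt (S.erase s ∪ C) (U \ C) hd rfl x
      rw [hcard, hcard'] at this
      rw [← this, lmarginal, lmarginal, ← lintegral_const_mul]
      · refine lintegral_congr fun y => ?_
        congr 1
        have h1 : Function.updateFinset x (U \ C) y s = x s := by
          simp [Function.updateFinset, hsU]
        rw [forestWeight, forestWeight, h1]
        congr 1
        refine vertexWeight_congr fun i hi => ?_
        simp [Function.updateFinset, hi]
      · exact (measurable_forestSum hφ _ _).comp measurable_updateFinset
    have hm : Measurable (fun x : Fin N → Pos d => forestWeight β φ x s C *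
        forestSum (forestWeight β φ x) (S.erase s ∪ C) (U \ C)) :=
      (measurable_forestWeight hφ _ _).mul (measurable_forestSum hφ _ _)
    have hun := lmarginal_union (fun _ => volume) _ hm hdis
    rw [← hUC, hinner] at hun
    rw [hun]
    have h2 := lmarginal_forestWeight (β := β) (φ := φ) (fun h => hsU (hC h)) x
    simp only
    rw [← h2, lmarginal, lmarginal, ← lintegral_mul_const]
    exact (measurable_forestWeight hφ _ _).comp measurable_updateFinset
  simp_rw [forestSum_explore _ hSU hs]
  have hsum : (∫⋯∫⁻_U, (fun x => ∑ C ∈ U.powerset, forestWeight β φ x s C *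
      forestSum (forestWeight β φ x) (S.erase s ∪ C) (U \ C)) ∂fun _ => volume) x =
      ∑ C ∈ U.powerset, (∫⋯∫⁻_U, (fun x => forestWeight β φ x s C *
        forestSum (forestWeight β φ x) (S.erase s ∪ C) (U \ C)) ∂fun _ => volume) x := by
    simp only [lmarginal]
    rw [lintegral_finsetSum]
    exact fun C _ => ((measurable_forestWeight hφ _ _).mul (measurable_forestSum hφ _ _)).comp
      measurable_updateFinset
  rw [hsum, sum_congr rfl hterm, sum_powerset_apply_card (fun j => vertexIntegral d β φ j *
    ((#U - j).factorial * forestCoeff (vertexIntegral d β φ) (j + (#S - 1)) (#U - j))), hS,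
    forestCoeff_succ, mul_sum]
  refine sum_congr rfl fun j hj => ?_
  have hj' : j ≤ #U := Nat.lt_succ_iff.1 (mem_range.1 hj)
  -- The choice of the `j` children among the labels in `U` accounts for the factor 1/j! in
  -- `forestCoeff`.
  have hf : ((#U).factorial : ℝ≥0∞) = (#U).choose j * j.factorial * (#U - j).factorial := by
    exact_mod_cast (Nat.choose_mul_factorial_mul_factorial hj').symm
  have h1 : (j.factorial : ℝ≥0∞) * (j.factorial : ℝ≥0∞)⁻¹ = 1 :=
    ENNReal.mul_inv_cancel (by simp [Nat.factorial_ne_zero]) (ENNReal.natCast_ne_top _)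
  rw [hf, nsmul_eq_mul, Nat.add_sub_cancel, div_eq_mul_inv]
  calc _ = (#U).choose j * (vertexIntegral d β φ j * ((#U - j).factorial *
      forestCoeff (vertexIntegral d β φ) (j + (#S - 1)) (#U - j))) * 1 := by rw [mul_one]
    _ = _ := by rw [← h1]; ring

/-- A rooted tree is a forest with the single root 0, here pinned at the origin. -/
lemma lintegral_treeWeight (hβ : 0 ≤ β) (hφ : Measurable φ) (n : ℕ) :
    ∫⁻ x : Fin n → Pos d,
      ENNReal.ofReal (treeWeight β φ (Fin.cons (0 : Pos d) x : Fin (n + 1) → Pos d)) =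
      n.factorial * forestCoeff (vertexIntegral d β φ) 1 n := by
  classical
  have hcard : #((univ : Finset (Fin (n + 1))).erase 0) = n := by simp
  have h := lmarginal_forestSum (d := d) (β := β) hφ (S := {0})
    (U := (univ : Finset (Fin (n + 1))).erase 0) (by simp) (fun _ => 0)
  rw [hcard, card_singleton] at h
  let f : Fin n → ((univ : Finset (Fin (n + 1))).erase 0) := fun i => ⟨i.succ, by simp⟩
  have hf : Function.Bijective f := by
    refine ⟨fun i j e => Fin.succ_injective _ (congrArg Subtype.val e), fun ⟨j, hj⟩ => ?_⟩
    obtain ⟨i, rfl⟩ := Fin.exists_succ_eq.2 (mem_erase.1 hj).1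
    exact ⟨i, rfl⟩
  rw [← h, lmarginal_eq_lintegral_equiv (Equiv.ofBijective f hf)]
  refine lintegral_congr fun u => ?_
  have hx : Function.updateFinset (fun _ => (0 : Pos d)) ((univ : Finset (Fin (n + 1))).erase 0)
      (u ∘ (Equiv.ofBijective f hf).symm) = Fin.cons 0 u := by
    ext1 j
    refine Fin.cases ?_ (fun i => ?_) j
    · simp [Function.updateFinset]
    · have : (⟨i.succ, by simp⟩ : ((univ : Finset (Fin (n + 1))).erase 0)) =
        Equiv.ofBijective f hf i := rfl
      simp [Function.updateFinset, this]
  rw [hx, ← sum_isTree_eq_forestSum, treeWeight, ENNReal.ofReal_sum_of_nonneg fun _ _ =>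
    prod_nonneg fun _ _ => vertexWeight_nonneg hβ _ _ _]
  refine sum_congr rfl fun τ _ => ?_
  rw [ENNReal.ofReal_prod_of_nonneg fun _ _ => vertexWeight_nonneg hβ _ _ _]
  rfl

lemma treeSum_eq (hβ : 0 ≤ β) (hφ : Measurable φ) (r : ℝ≥0∞) :
    treeSum d β φ r = ∑' n, r ^ n * forestCoeff (vertexIntegral d β φ) 1 n := by
  refine tsum_congr fun n => ?_
  rw [lintegral_treeWeight hβ hφ, ← mul_assoc]
  congr 1
  exact ENNReal.div_mul_cancel (by simp [Nat.factorial_ne_zero]) (ENNReal.natCast_ne_top _)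

end TreeIntegral

end RepulsiveGas

/-! ### Entire functions with a prescribed logarithmic derivative. -/

namespace RepulsiveGas

open MeasureTheory Finset

section EntireFunction

variable {a γ : ℕ → ℝ} {B : ℝ}

/-- The sum of an everywhere convergent power series with real coefficients. -/
noncomputable def powerSum (a : ℕ → ℝ) (ζ : ℂ) : ℂ := ∑' n, (a n : ℂ) * ζ ^ n

lemma summable_of_le_pow_div_factorial (ha : ∀ n, |a n| ≤ B ^ n / n.factorial) (ζ : ℂ) :
    Summable fun n => ‖(a n : ℂ) * ζ ^ n‖ := by
  refine Summable.of_nonneg_of_le (fun n => norm_nonneg _) (fun n => ?_)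
    (Real.summable_pow_div_factorial (B * ‖ζ‖))
  rw [norm_mul, norm_pow, Complex.norm_real, Real.norm_eq_abs, mul_pow, mul_div_right_comm]
  exact mul_le_mul_of_nonneg_right (ha n) (by positivity)

lemma hasDerivAt_powerSum (ha : ∀ n, |a n| ≤ B ^ n / n.factorial) (ζ : ℂ) :
    HasDerivAt (powerSum a) (∑' n : ℕ, ((n + 1) * a (n + 1) : ℝ) * ζ ^ n) ζ := by
  have hB : 0 ≤ B := by simpa using (abs_nonneg _).trans (ha 1)
  set R := ‖ζ‖ + 1 with hR
  have hR0 : 0 ≤ R := by positivity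
  have hu : Summable fun n : ℕ => (n : ℝ) * (B ^ n / n.factorial) * R ^ (n - 1) := by
    rw [← summable_nat_add_iff 1]
    refine ((Real.summable_pow_div_factorial (B * R)).mul_left B).congr fun n => ?_
    rw [Nat.factorial_succ]
    push_cast
    have : (n.factorial : ℝ) ≠ 0 := by positivity
    have h2 : (n : ℝ) + 1 ≠ 0 := by positivity
    field_simp
    ring_nf
  have key := hasDerivAt_tsum_of_isPreconnected (𝕜 := ℂ) (F := ℂ)
    (g := fun n ζ => (a n : ℂ) * ζ ^ n) (g' := fun n ζ => (a n : ℂ) * (n * ζ ^ (n - 1)))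
    (t := Metric.ball 0 R) (y₀ := 0) (y := ζ) hu Metric.isOpen_ball
    (convex_ball _ _).isPreconnected (fun n y _ => (hasDerivAt_pow n y).const_mul _)
    (fun n y hy => ?_) (by simp [hR]; positivity)
    (summable_of_le_pow_div_factorial ha 0).of_norm (by simp [hR])
  · refine key.congr_deriv ?_
    rw [Summable.tsum_eq_zero_add]
    · simp only [Nat.cast_zero, zero_mul, mul_zero, zero_add, Nat.add_sub_cancel]
      refine tsum_congr fun n => ?_
      push_cast; ring
    · refine Summable.of_norm_bounded hu fun n => ?_
      have h1 : ‖ζ‖ ≤ R := by simp [hR]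
      rw [norm_mul, norm_mul, norm_pow, Complex.norm_real, Complex.norm_natCast,
        Real.norm_eq_abs, ← mul_assoc, mul_comm |a n|]
      gcongr
      exact ha n
  · have h1 : ‖y‖ ≤ R := by exact (mem_ball_zero_iff.1 hy).le
    rw [norm_mul, norm_mul, norm_pow, Complex.norm_real, Complex.norm_natCast,
      Real.norm_eq_abs, ← mul_assoc, mul_comm |a n|]
    gcongr
    exact ha n

/-- The recurrence is the Cauchy product form of F' = ΓF. Absolute convergence of Γ at `ζ` makes it
an identity of functions there. -/
lemma hasDerivAt_powerSum_of_recurrence (ha : ∀ n, |a n| ≤ B ^ n / n.factorial)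
    (hγ : ∀ n, (n + 1) * a (n + 1) = ∑ p ∈ antidiagonal n, γ p.1 * a p.2)
    {ζ : ℂ} (hs : Summable fun n => |γ n| * ‖ζ‖ ^ n) :
    HasDerivAt (powerSum a) (powerSum γ ζ * powerSum a ζ) ζ := by
  refine (hasDerivAt_powerSum ha ζ).congr_deriv (Eq.symm ?_)
  have h1 : Summable fun n => ‖(γ n : ℂ) * ζ ^ n‖ := by
    simpa [norm_mul, norm_pow] using hs
  rw [powerSum, powerSum, tsum_mul_tsum_eq_tsum_sum_antidiagonal_of_summable_norm h1
    (summable_of_le_pow_div_factorial ha ζ)]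
  refine tsum_congr fun n => ?_
  rw [hγ, Complex.ofReal_sum, sum_mul]
  refine sum_congr rfl fun p hp => ?_
  rw [← (HasAntidiagonal.mem_antidiagonal.1 hp), pow_add]
  push_cast; ring

/-- The logarithmic derivative along the segment from `0` to `z`, extended continuously. -/
noncomputable def segmentLogDeriv (γ : ℕ → ℝ) (z : ℂ) (t : ℝ) : ℂ :=
  z * powerSum γ ((max 0 (min t 1) : ℝ) * z)

lemma norm_clamp_mul_le (z : ℂ) (t : ℝ) : ‖((max 0 (min t 1) : ℝ) : ℂ) * z‖ ≤ ‖z‖ := by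
  rw [norm_mul, Complex.norm_real, Real.norm_of_nonneg (le_max_left _ _)]
  exact mul_le_of_le_one_left (norm_nonneg _) (max_le zero_le_one (min_le_right _ _))

lemma continuous_segmentLogDeriv {z : ℂ} (hs : Summable fun n => |γ n| * ‖z‖ ^ n) :
    Continuous (segmentLogDeriv γ z) := by
  unfold segmentLogDeriv powerSum
  refine continuous_const.mul (continuous_tsum (fun n => by fun_prop) hs fun n t => ?_)
  rw [norm_mul, norm_pow, Complex.norm_real, Real.norm_eq_abs]
  gcongr
  exact norm_clamp_mul_le z t

lemma segmentLogDeriv_of_mem {z : ℂ} {t : ℝ} (ht : t ∈ Set.Icc (0 : ℝ) 1) :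
    segmentLogDeriv γ z t = z * powerSum γ (t * z) := by
  rw [segmentLogDeriv, min_eq_left ht.2, max_eq_right ht.1]

/-- With H the integral of the would-be logarithmic derivative, F(tz) e^{-H(t)} has zero derivative
and starts at 1. No division by F occurs, so zero-freeness is a consequence. -/
lemma powerSum_eq_exp_integral (ha : ∀ n, |a n| ≤ B ^ n / n.factorial)
    (ha0 : a 0 = 1) (hγ : ∀ n, (n + 1) * a (n + 1) = ∑ p ∈ antidiagonal n, γ p.1 * a p.2)
    {z : ℂ} (hs : Summable fun n => |γ n| * ‖z‖ ^ n) {t : ℝ}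
    (ht : t ∈ Set.Icc (0 : ℝ) 1) :
    powerSum a (t * z) = Complex.exp (∫ s in (0 : ℝ)..t, segmentLogDeriv γ z s) := by
  have hc := continuous_segmentLogDeriv hs
  set H : ℝ → ℂ := fun t => ∫ s in (0 : ℝ)..t, segmentLogDeriv γ z s with hH
  have hHd : ∀ t, HasDerivAt H (segmentLogDeriv γ z t) t := fun t =>
    intervalIntegral.integral_hasDerivAt_right (hc.intervalIntegrable _ _)
      (hc.stronglyMeasurableAtFilter _ _) hc.continuousAt
  have hFd : ∀ t ∈ Set.Icc (0 : ℝ) 1, HasDerivAt (fun t : ℝ => powerSum a (t * z))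
      (segmentLogDeriv γ z t * powerSum a (t * z)) t := by
    intro t ht
    have hle : ‖(t : ℂ) * z‖ ≤ ‖z‖ := by
      rw [norm_mul, Complex.norm_real, Real.norm_of_nonneg ht.1]
      exact mul_le_of_le_one_left (norm_nonneg _) ht.2
    have hst : Summable fun n => |γ n| * ‖(t : ℂ) * z‖ ^ n :=
      Summable.of_nonneg_of_le (fun n => by positivity) (fun n => by gcongr) hs
    have h1 := hasDerivAt_powerSum_of_recurrence ha hγ hst
    have h2 : HasDerivAt (fun t : ℝ => (t : ℂ) * z) z t := by
      simpa using (Complex.ofRealCLM.hasDerivAt (x := t)).mul_const z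
    have h3 := h1.comp t h2
    rw [segmentLogDeriv_of_mem ht]
    exact h3.congr_deriv (by ring)
  have hconst : ∀ t ∈ Set.Icc (0 : ℝ) 1,
      powerSum a (t * z) * Complex.exp (-H t) =
        powerSum a ((0 : ℝ) * z) * Complex.exp (-H 0) := by
    have hd : ∀ t ∈ Set.Icc (0 : ℝ) 1,
        HasDerivAt (fun t : ℝ => powerSum a (t * z) * Complex.exp (-H t)) 0 t := by
      intro t ht
      exact ((hFd t ht).mul (hHd t).neg.cexp).congr_deriv (by ring_nf)
    exact constant_of_has_deriv_right_zero
      (fun t ht => (hd t ht).continuousAt.continuousWithinAt)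
      (fun t ht => (hd t ⟨ht.1, ht.2.le⟩).hasDerivWithinAt)
  have h0 : powerSum a ((0 : ℝ) * z) = 1 := by
    rw [powerSum, tsum_eq_single 0]
    · simp [ha0]
    · intro n hn; simp [hn]
  have := hconst t ht
  rw [h0, Complex.exp_neg, ← div_eq_mul_inv, div_eq_iff (Complex.exp_ne_zero _)] at this
  simpa [hH] using this

lemma powerSum_ne_zero (ha : ∀ n, |a n| ≤ B ^ n / n.factorial)
    (ha0 : a 0 = 1) (hγ : ∀ n, (n + 1) * a (n + 1) = ∑ p ∈ antidiagonal n, γ p.1 * a p.2)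
    {z : ℂ} (hs : Summable fun n => |γ n| * ‖z‖ ^ n) : powerSum a z ≠ 0 := by
  have := powerSum_eq_exp_integral ha ha0 hγ hs (t := 1) (by simp)
  rw [Complex.ofReal_one, one_mul] at this
  rw [this]
  exact Complex.exp_ne_zero _

lemma logFromOrigin_powerSum_eq_integral (ha : ∀ n, |a n| ≤ B ^ n / n.factorial)
    (ha0 : a 0 = 1) (hγ : ∀ n, (n + 1) * a (n + 1) = ∑ p ∈ antidiagonal n, γ p.1 * a p.2)
    {z : ℂ} (hs : Summable fun n => |γ n| * ‖z‖ ^ n) :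
    logFromOrigin (powerSum a) z = ∫ t in (0 : ℝ)..1, segmentLogDeriv γ z t := by
  refine intervalIntegral.integral_congr fun t ht => ?_
  rw [Set.uIcc_of_le zero_le_one] at ht
  have hle : ‖(t : ℂ) * z‖ ≤ ‖z‖ := by
    rw [norm_mul, Complex.norm_real, Real.norm_of_nonneg ht.1]
    exact mul_le_of_le_one_left (norm_nonneg _) ht.2
  have hst : Summable fun n => |γ n| * ‖(t : ℂ) * z‖ ^ n :=
    Summable.of_nonneg_of_le (fun n => by positivity) (fun n => by gcongr) hs
  rw [(hasDerivAt_powerSum_of_recurrence ha hγ hst).deriv, segmentLogDeriv_of_mem ht,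
    mul_div_cancel_right₀ _ (powerSum_ne_zero ha ha0 hγ hst)]

lemma exp_logFromOrigin_powerSum (ha : ∀ n, |a n| ≤ B ^ n / n.factorial)
    (ha0 : a 0 = 1) (hγ : ∀ n, (n + 1) * a (n + 1) = ∑ p ∈ antidiagonal n, γ p.1 * a p.2)
    {z : ℂ} (hs : Summable fun n => |γ n| * ‖z‖ ^ n) :
    Complex.exp (logFromOrigin (powerSum a) z) = powerSum a z := by
  have := powerSum_eq_exp_integral ha ha0 hγ hs (t := 1) (by simp)
  rw [logFromOrigin_powerSum_eq_integral ha ha0 hγ hs, ← this, Complex.ofReal_one, one_mul]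

/-- Termwise integration along the segment, dominated by the series at |z|. -/
lemma logFromOrigin_powerSum_eq_tsum (ha : ∀ n, |a n| ≤ B ^ n / n.factorial)
    (ha0 : a 0 = 1) (hγ : ∀ n, (n + 1) * a (n + 1) = ∑ p ∈ antidiagonal n, γ p.1 * a p.2)
    {z : ℂ} (hs : Summable fun n => |γ n| * ‖z‖ ^ n) :
    logFromOrigin (powerSum a) z = ∑' n : ℕ, (γ n : ℂ) * (z ^ (n + 1) / (n + 1)) := by
  rw [logFromOrigin_powerSum_eq_integral ha ha0 hγ hs]
  have h := intervalIntegral.hasSum_integral_of_dominated_convergence (μ := volume) (a := 0)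
    (b := 1) (F := fun (n : ℕ) (t : ℝ) => z * ((γ n : ℂ) * ((t : ℂ) * z) ^ n))
    (f := segmentLogDeriv γ z) (fun n _ => ‖z‖ * (|γ n| * ‖z‖ ^ n))
    (fun n => Continuous.aestronglyMeasurable (by fun_prop))
    (fun n => ae_of_all _ fun t ht => ?_) (ae_of_all _ fun t _ => hs.mul_left _)
    intervalIntegrable_const (ae_of_all _ fun t ht => ?_)
  · rw [← h.tsum_eq]
    refine tsum_congr fun n => ?_
    have : ∀ t : ℝ, z * ((γ n : ℂ) * ((t : ℂ) * z) ^ n) = (γ n * z ^ (n + 1)) * (t : ℂ) ^ n :=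
      fun t => by ring
    simp_rw [this]
    rw [intervalIntegral.integral_const_mul]
    have h2 : ∫ t in (0 : ℝ)..1, (t : ℂ) ^ n = 1 / (n + 1) := by
      have := integral_pow (a := 0) (b := 1) n
      have h3 : ∫ t in (0 : ℝ)..1, (t : ℂ) ^ n = ((∫ t in (0 : ℝ)..1, t ^ n : ℝ) : ℂ) := by
        rw [← intervalIntegral.integral_ofReal]
        push_cast; rfl
      rw [h3, this]; simp
    rw [h2]; ring
  · rw [Set.uIoc_of_le zero_le_one] at ht
    rw [norm_mul, norm_mul, norm_pow, norm_mul, Complex.norm_real, Complex.norm_real,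
      Real.norm_eq_abs, Real.norm_of_nonneg ht.1.le]
    have := mul_le_of_le_one_left (norm_nonneg z) ht.2
    have := mul_nonneg ht.1.le (norm_nonneg z)
    gcongr
  · rw [Set.uIoc_of_le zero_le_one] at ht
    rw [segmentLogDeriv_of_mem ⟨ht.1.le, ht.2⟩]
    refine HasSum.mul_left _ (Summable.hasSum (Summable.of_norm_bounded hs fun n => ?_))
    rw [norm_mul, norm_pow, norm_mul, Complex.norm_real, Complex.norm_real,
      Real.norm_eq_abs, Real.norm_of_nonneg ht.1.le]
    have := mul_le_of_le_one_left (norm_nonneg z) ht.2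
    have := mul_nonneg ht.1.le (norm_nonneg z)
    gcongr

end EntireFunction

end RepulsiveGas

/-! ### The logarithmic derivative of the partition function. -/

namespace RepulsiveGas

open MeasureTheory Finset

/-- The coefficients of the logarithmic derivative of the partition function. -/
noncomputable def logCoeff {d : ℕ} (β : ℝ) (φ : ℝ≥0 → ℝ≥0∞) (w : Pos d → ℝ) (n : ℕ) : ℝ :=
  PowerSeries.coeff n (PowerSeries.derivative ℝ (configSeries β φ w) * (configSeries β φ w)⁻¹)

/-- The coefficients of the ratio of the partition functions with and without fixed particles at
the points `u i`. -/
noncomputable def ratioCoeff {d : ℕ} (β : ℝ) (φ : ℝ≥0 → ℝ≥0∞) (w : Pos d → ℝ) {k : ℕ}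
    (u : Fin k → Pos d) (m : ℕ) : ℝ :=
  PowerSeries.coeff m (configSeries β φ (screened β φ w u) * (configSeries β φ w)⁻¹)

section Gas

variable {d : ℕ} {β : ℝ} {φ : ℝ≥0 → ℝ≥0∞} {w : Pos d → ℝ}

lemma logCoeff_recurrence (w : Pos d → ℝ) (n : ℕ) :
    (n + 1) * (configIntegral β φ w (n + 1) / (n + 1).factorial) =
      ∑ p ∈ antidiagonal n,
        logCoeff β φ w p.1 * (configIntegral β φ w p.2 / p.2.factorial) := by
  have h : PowerSeries.derivative ℝ (configSeries β φ w) = PowerSeries.derivative ℝ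
      (configSeries β φ w) * (configSeries β φ w)⁻¹ * configSeries β φ w := by
    rw [mul_assoc, mul_comm (configSeries β φ w)⁻¹, configSeries_mul_inv, mul_one]
  have h2 := congrArg (PowerSeries.coeff n) h
  rw [PowerSeries.coeff_mul, PowerSeries.coeff_derivative] at h2
  simp only [configSeries, PowerSeries.coeff_mk] at h2
  rw [mul_comm]
  exact h2

lemma measurable_ratioCoeff {α : Type*} [MeasurableSpace α] (hφ : Measurable φ)
    (hw : IsActivity w) {k : ℕ} {f : α → Fin k → Pos d} (hf : Measurable f) (m : ℕ) :
    Measurable (fun a => ratioCoeff β φ w (f a) m) :=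
  (measurable_coeff_configSeries hφ (hw.measurable_screened_uncurry hφ k) _ m).comp hf

lemma IsActivity.enorm_ratioCoeff_le (hw : IsActivity w) (hβ : 0 ≤ β) (hφ : Measurable φ)
    {k : ℕ} (u : Fin k → Pos d) (m : ℕ) :
    ‖ratioCoeff β φ w u m‖ₑ ≤ forestCoeff (vertexIntegral d β φ) k m :=
  hw.enorm_coeff_ratio_le hβ hφ k m u

/-- Differentiating Z(w) singles out one particle, at `y`, which then screens the others: Z(w)' = ∫
w(y) Z(w screened by y) dy. Divide by Z(w). -/
lemma IsActivity.logCoeff_eq_integral (hw : IsActivity w) (hβ : 0 ≤ β) (hφ : Measurable φ)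
    (n : ℕ) : logCoeff β φ w n = ∫ y, w y * ratioCoeff β φ w (fun _ : Fin 1 => y) n := by
  have hm : ∀ k, Measurable fun y : Pos d =>
      configIntegral β φ (screened β φ w (fun _ : Fin 1 => y)) k := fun k =>
    measurable_configIntegral hφ (W := fun y => screened β φ w (fun _ : Fin 1 => y))
      (measurable_screened hφ hw.measurable (f := fun p : Pos d × Pos d => fun _ : Fin 1 => p.1)
        (measurable_pi_lambda _ fun _ => measurable_fst) measurable_snd) k
  have hi : ∀ k, Integrable fun y : Pos d =>
      w y * configIntegral β φ (screened β φ w (fun _ : Fin 1 => y)) k := by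
    intro k
    refine hw.integrable.mul_bdd (c := (∫ v, w v) ^ k) (hm k).aestronglyMeasurable
      (ae_of_all _ fun y => ?_)
    have hs := hw.isActivity_screened hβ hφ (fun _ : Fin 1 => y)
    rw [Real.norm_of_nonneg (configIntegral_nonneg hs.nonneg _)]
    refine (hs.configIntegral_le hβ hφ _).trans ?_
    have h0 : 0 ≤ ∫ v, screened β φ w (fun _ : Fin 1 => y) v := integral_nonneg hs.nonneg
    have h1 : ∫ v, screened β φ w (fun _ : Fin 1 => y) v ≤ ∫ v, w v :=
      integral_mono hs.integrable hw.integrable (screened_le hβ hw.nonneg _)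
    gcongr
  simp only [logCoeff, ratioCoeff, PowerSeries.coeff_mul, PowerSeries.coeff_derivative]
  simp only [configSeries, PowerSeries.coeff_mk, mul_sum]
  rw [integral_finsetSum]
  · refine sum_congr rfl fun p _ => ?_
    have : ∀ y : Pos d, w y * (configIntegral β φ (screened β φ w (fun _ : Fin 1 => y)) p.1 /
        p.1.factorial * PowerSeries.coeff p.2
          (PowerSeries.mk fun N => configIntegral β φ w N / N.factorial)⁻¹) =
        w y * configIntegral β φ (screened β φ w (fun _ : Fin 1 => y)) p.1 *
        (PowerSeries.coeff p.2 (PowerSeries.mk fun N =>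
          configIntegral β φ w N / N.factorial)⁻¹ / p.1.factorial) := fun y => by ring
    simp_rw [this]
    rw [integral_mul_const, ← hw.configIntegral_succ hβ hφ, Nat.factorial_succ]
    have h1 : (p.1.factorial : ℝ) ≠ 0 := by positivity
    have h2 : (p.1 : ℝ) + 1 ≠ 0 := by positivity
    push_cast
    field_simp
  · intro p _
    simpa only [mul_assoc, div_eq_mul_inv] using ((hi p.1).mul_const
      ((p.1.factorial : ℝ)⁻¹ * PowerSeries.coeff p.2 (PowerSeries.mk fun N =>
          configIntegral β φ w N / N.factorial)⁻¹))

lemma isActivity_indicator {Λ : Set (Pos d)} (hm : MeasurableSet Λ) (hΛ : volume Λ < ⊤) :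
    IsActivity (Λ.indicator fun _ => (1 : ℝ)) where
  measurable := measurable_const.indicator hm
  nonneg _ := Set.indicator_nonneg (fun _ _ => zero_le_one) _
  le_one _ := Set.indicator_le_self' (fun _ _ => zero_le_one) _
  integrable := (integrable_indicator_iff hm).2 (integrableOn_const hΛ.ne)

lemma partitionFunction_eq_powerSum {Λ : Set (Pos d)} (hm : MeasurableSet Λ) :
    partitionFunction β φ Λ = powerSum fun N =>
      configIntegral β φ (Λ.indicator fun _ => (1 : ℝ)) N / N.factorial := by
  ext z
  refine tsum_congr fun N => ?_
  have h : ∫ x : Fin N → Pos d in Set.univ.pi (fun _ => Λ), boltzmann β (energy φ x) =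
      configIntegral β φ (Λ.indicator fun _ => (1 : ℝ)) N := by
    rw [← integral_indicator (MeasurableSet.univ_pi fun _ => hm), configIntegral]
    refine integral_congr_ae (ae_of_all _ fun x => ?_)
    simp only
    by_cases hx : x ∈ Set.univ.pi (fun _ : Fin N => Λ)
    · have hx' : ∀ i, x i ∈ Λ := fun i => hx i (Set.mem_univ i)
      simp [hx', boltzmann_energy]
    · have hx' : ∃ i, x i ∉ Λ := by simpa using hx
      obtain ⟨i, hi⟩ := hx'
      simp only [Set.indicator_of_notMem hx]
      rw [prod_eq_zero (mem_univ i) (by simp [hi]), zero_mul]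
  rw [h]
  push_cast
  ring

lemma IsActivity.abs_configIntegral_div_le (hw : IsActivity w) (hβ : 0 ≤ β) (hφ : Measurable φ)
    (n : ℕ) : |configIntegral β φ w n / n.factorial| ≤ (∫ u, w u) ^ n / n.factorial := by
  rw [abs_of_nonneg (div_nonneg (configIntegral_nonneg hw.nonneg _) (by positivity))]
  gcongr
  exact hw.configIntegral_le hβ hφ n

lemma IsActivity.enorm_logCoeff_le (hw : IsActivity w) (hβ : 0 ≤ β) (hφ : Measurable φ) (n : ℕ) :
    ‖logCoeff β φ w n‖ₑ ≤
      ENNReal.ofReal (∫ u, w u) * forestCoeff (vertexIntegral d β φ) 1 n := by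
  rw [hw.logCoeff_eq_integral hβ hφ]
  refine (enorm_integral_le_lintegral_enorm _).trans ?_
  rw [ofReal_integral_eq_lintegral_ofReal hw.integrable (ae_of_all _ hw.nonneg),
    ← lintegral_mul_const _ hw.measurable.ennreal_ofReal]
  refine lintegral_mono fun y => ?_
  rw [enorm_mul, Real.enorm_of_nonneg (hw.nonneg y)]
  gcongr
  exact hw.enorm_ratioCoeff_le hβ hφ _ n

lemma ratioCoeff_comp_add (w : Pos d → ℝ) (a : Pos d) {k : ℕ} (u : Fin k → Pos d) (m : ℕ) :
    ratioCoeff β φ (fun v => w (v + a)) u m = ratioCoeff β φ w (fun i => u i + a) m := by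
  have h1 : configSeries β φ (fun v => w (v + a)) = configSeries β φ w := by
    ext N; simp [configSeries, configIntegral_comp_add]
  have h2 : screened β φ (fun v => w (v + a)) u =
      fun v => screened β φ w (fun i => u i + a) (v + a) := by
    ext v; simp [screened, pairWeight_add_right]
  have h3 : configSeries β φ (screened β φ (fun v => w (v + a)) u) =
      configSeries β φ (screened β φ w (fun i => u i + a)) := by
    rw [h2]; ext N; simp [configSeries, configIntegral_comp_add]
  rw [ratioCoeff, ratioCoeff, h1, h3]

end Gas

end RepulsiveGas

/-! ### Locality of the ratio coefficients. -/

namespace RepulsiveGas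

open MeasureTheory Finset Filter Topology

section Locality

variable {d : ℕ} {β : ℝ} {φ : ℝ≥0 → ℝ≥0∞}

/-- The part of the vertex integral with some child at distance at least `R`. -/
noncomputable def vertexTail (d : ℕ) (β : ℝ) (φ : ℝ≥0 → ℝ≥0∞) (n : ℕ) (R : ℝ) : ℝ≥0∞ :=
  ∫⁻ t : Fin n → Pos d, {t | ∃ i, R ≤ dist (t i) 0}.indicator
    (fun t => ENNReal.ofReal (vertexWeight β φ 0 univ t)) t

lemma measurableSet_exists_le_dist {n : ℕ} (y : Pos d) (R : ℝ) :
    MeasurableSet {t : Fin n → Pos d | ∃ i, R ≤ dist (t i) y} := by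
  simp only [Set.ofPred_exists]
  exact MeasurableSet.iUnion fun i => measurableSet_le measurable_const
    ((measurable_pi_apply i).dist measurable_const)

lemma lintegral_vertexWeight_far (y : Pos d) (n : ℕ) (R : ℝ) :
    ∫⁻ t : Fin n → Pos d, {t | ∃ i, R ≤ dist (t i) y}.indicator
      (fun t => ENNReal.ofReal (vertexWeight β φ y univ t)) t = vertexTail d β φ n R := by
  have h := lintegral_add_right_eq_self (μ := (volume : Measure (Fin n → Pos d)))
    (fun t : Fin n → Pos d => {t | ∃ i, R ≤ dist (t i) y}.indicator
      (fun t => ENNReal.ofReal (vertexWeight β φ y univ t)) t) (fun _ => y)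
  rw [← h, vertexTail]
  refine lintegral_congr fun u => ?_
  have h1 := vertexWeight_add_right (β := β) (φ := φ) 0 y univ u
  rw [zero_add] at h1
  have h2 : ∀ i, dist (u i + y) y = dist (u i) 0 := fun i => by simp [dist_eq_norm]
  have h3 : (u + fun _ : Fin n => y) = fun i => u i + y := rfl
  simp only [h3, Set.indicator, Set.mem_ofPred_eq, h2, h1]

/-- A given configuration has all its points within distance R of the origin once R is large;
dominated convergence does the rest. -/
lemma tendsto_vertexTail (hφ : Measurable φ) {n : ℕ} (hg : vertexIntegral d β φ n < ⊤) :
    Tendsto (vertexTail d β φ n) atTop (𝓝 0) := by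
  have hm : Measurable fun t : Fin n → Pos d => ENNReal.ofReal (vertexWeight β φ 0 univ t) :=
    (measurable_vertexWeight hφ _ measurable_const measurable_id).ennreal_ofReal
  have h := tendsto_lintegral_filter_of_dominated_convergence (l := (atTop : Filter ℝ))
    (μ := (volume : Measure (Fin n → Pos d)))
    (F := fun R t => {t | ∃ i, R ≤ dist (t i) 0}.indicator
      (fun t : Fin n → Pos d => ENNReal.ofReal (vertexWeight β φ 0 univ t)) t) (f := fun _ => 0)
    (fun t => ENNReal.ofReal (vertexWeight β φ 0 univ t))
    (Eventually.of_forall fun R => hm.indicator (measurableSet_exists_le_dist 0 R))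
    (Eventually.of_forall fun R => ae_of_all _ fun t => Set.indicator_le_self _ _ _) hg.ne
    (ae_of_all _ fun t => ?_)
  · rw [lintegral_zero] at h
    exact h
  · refine tendsto_const_nhds.congr' ?_
    have : ∀ᶠ R in (atTop : Filter ℝ), ∀ i, dist (t i) 0 < R :=
      eventually_all.2 fun i => eventually_gt_atTop _
    filter_upwards [this] with R hR
    rw [Set.indicator_of_notMem]
    simpa using hR

/-- The largest change of a coefficient of the ratio of partition functions when the activity
profile is changed away from the balls of radius `h` around the fixed particles. -/
noncomputable def localityError (d : ℕ) (β : ℝ) (φ : ℝ≥0 → ℝ≥0∞) (k m : ℕ) (h : ℝ) : ℝ≥0∞ :=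
  ⨆ (u : Fin k → Pos d) (w : Pos d → ℝ) (w' : Pos d → ℝ) (_ : IsActivity w) (_ : IsActivity w')
    (_ : ∀ i, ∀ v ∈ Metric.ball (u i) h, w v = w' v),
      ‖ratioCoeff β φ w u m - ratioCoeff β φ w' u m‖ₑ

lemma le_localityError {k m : ℕ} {h : ℝ} {u : Fin k → Pos d} {w w' : Pos d → ℝ}
    (hw : IsActivity w) (hw' : IsActivity w') (hww' : ∀ i, ∀ v ∈ Metric.ball (u i) h, w v = w' v) :
    ‖ratioCoeff β φ w u m - ratioCoeff β φ w' u m‖ₑ ≤ localityError d β φ k m h :=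
  le_iSup_of_le u <| le_iSup_of_le w <| le_iSup_of_le w' <| le_iSup_of_le hw <|
    le_iSup_of_le hw' <| le_iSup_of_le hww' le_rfl

lemma localityError_zero (m : ℕ) (h : ℝ) : localityError d β φ 0 m h = 0 := by
  simp only [localityError, ENNReal.iSup_eq_zero]
  intro u w w' _ _ _
  have : ∀ w : Pos d → ℝ, ratioCoeff β φ w u m = PowerSeries.coeff m (1 : PowerSeries ℝ) := by
    intro w
    have : screened β φ w u = w := by ext v; simp [screened]
    rw [ratioCoeff, this, configSeries_mul_inv]
  rw [this, this, sub_self, enorm_zero]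

lemma ratioCoeff_succ (hβ : 0 ≤ β) (hφ : Measurable φ) {w : Pos d → ℝ} (hw : IsActivity w)
    {k : ℕ} (u : Fin (k + 1) → Pos d) (m : ℕ) :
    ratioCoeff β φ w u m = ∑ n ∈ range (m + 1), (-1) ^ n / n.factorial *
      ∫ t : Fin n → Pos d, vertexWeight β φ (u 0) univ t *
        (∏ i, screened β φ w (Fin.tail u) (t i)) *
          ratioCoeff β φ w (Fin.append t (Fin.tail u)) (m - n) := by
  rw [ratioCoeff, screened_cons,
    (hw.isActivity_screened hβ hφ _).coeff_configSeries_screened hβ hφ]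
  simp only [ratioCoeff, screened_append]

lemma IsActivity.abs_ratioCoeff_le {w : Pos d → ℝ} (hw : IsActivity w) (hβ : 0 ≤ β)
    (hφ : Measurable φ) (hg : ∀ n, vertexIntegral d β φ n < ⊤) {k : ℕ} (u : Fin k → Pos d)
    (m : ℕ) : |ratioCoeff β φ w u m| ≤ (forestCoeff (vertexIntegral d β φ) k m).toReal := by
  have h := hw.enorm_ratioCoeff_le hβ hφ u m
  rw [Real.enorm_eq_ofReal_abs] at h
  exact (ENNReal.ofReal_le_iff_le_toReal (forestCoeff_lt_top hg k m).ne).1 h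

/-- If all children lie within h/2 of the explored root, their activities agree for the two
profiles, and the h/2-balls around them stay in the region of agreement: the error recurs at radius
h/2. Otherwise each ratio is bounded crudely, and the tail of the vertex integral is small. -/
lemma localityError_succ_le (hβ : 0 ≤ β) (hφ : Measurable φ)
    (hg : ∀ n, vertexIntegral d β φ n < ⊤) (k m : ℕ) {h : ℝ} (hh : 0 ≤ h) :
    localityError d β φ (k + 1) m h ≤ ∑ n ∈ range (m + 1),
      (vertexIntegral d β φ n * localityError d β φ (n + k) (m - n) (h / 2) +
        2 * forestCoeff (vertexIntegral d β φ) (n + k) (m - n) * vertexTail d β φ n (h / 2)) := by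
  simp only [localityError, iSup_le_iff]
  intro u w w' hw hw' hww'
  rw [ratioCoeff_succ hβ hφ hw, ratioCoeff_succ hβ hφ hw', ← sum_sub_distrib]
  refine (enorm_sum_le _ _).trans (sum_le_sum fun n _ => ?_)
  have hint : ∀ {w : Pos d → ℝ}, IsActivity w → Integrable fun t : Fin n → Pos d =>
      vertexWeight β φ (u 0) univ t * (∏ i, screened β φ w (Fin.tail u) (t i)) *
        ratioCoeff β φ w (Fin.append t (Fin.tail u)) (m - n) := fun {w} hw =>
    (hw.isActivity_screened hβ hφ _).integrable_vertexWeight_mul hβ hφ _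
      (measurable_ratioCoeff hφ hw (measurable_pi_lambda _ fun i => by
        refine Fin.addCases (fun i => ?_) (fun i => ?_) i
        · simpa using measurable_pi_apply i
        · simp) _) fun t => hw.abs_ratioCoeff_le hβ hφ hg _ _
  rw [← mul_sub, ← integral_sub (hint hw) (hint hw'), enorm_mul]
  have hc : ‖(-1 : ℝ) ^ n / (n.factorial : ℝ)‖ₑ ≤ 1 := by
    rw [Real.enorm_eq_ofReal_abs, abs_div, abs_pow, abs_neg, abs_one, one_pow, Nat.abs_cast]
    refine ENNReal.ofReal_le_one.2 (div_le_one_of_le₀ ?_ (by positivity))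
    exact_mod_cast n.factorial_pos
  refine (mul_le_of_le_one_left zero_le hc).trans ?_
  refine (enorm_integral_le_lintegral_enorm _).trans ?_
  have hm : Measurable fun t : Fin n → Pos d => ENNReal.ofReal (vertexWeight β φ (u 0) univ t) :=
    (measurable_vertexWeight hφ _ measurable_const measurable_id).ennreal_ofReal
  rw [← lintegral_vertexWeight (u 0), ← lintegral_vertexWeight_far (u 0),
    ← lintegral_mul_const _ hm,
    ← lintegral_const_mul _ (hm.indicator (measurableSet_exists_le_dist (u 0) (h / 2))),
    ← lintegral_add_left (hm.mul_const _)]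
  refine lintegral_mono fun t => ?_
  have hP : ∀ {w : Pos d → ℝ}, IsActivity w →
      ‖∏ i, screened β φ w (Fin.tail u) (t i)‖ₑ ≤ 1 := fun {w} hw => by
    have hs := hw.isActivity_screened hβ hφ (Fin.tail u)
    rw [Real.enorm_of_nonneg (prod_activity_nonneg hs.nonneg t)]
    exact ENNReal.ofReal_le_one.2 (prod_le_one (fun _ _ => hs.nonneg _) fun _ _ => hs.le_one _)
  simp only
  rw [mul_assoc, mul_assoc, ← mul_sub, enorm_mul,
    Real.enorm_of_nonneg (vertexWeight_nonneg hβ _ _ _)]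
  by_cases ht : ∃ i, h / 2 ≤ dist (t i) (u 0)
  · rw [Set.indicator_of_mem (s := {t : Fin n → Pos d | ∃ i, h / 2 ≤ dist (t i) (u 0)}) ht,
      mul_comm (2 * _)]
    refine le_add_left ?_
    gcongr
    refine (enorm_sub_le).trans ?_
    rw [two_mul, enorm_mul, enorm_mul]
    exact add_le_add
      ((mul_le_of_le_one_left zero_le (hP hw)).trans (hw.enorm_ratioCoeff_le hβ hφ _ _))
      ((mul_le_of_le_one_left zero_le (hP hw')).trans (hw'.enorm_ratioCoeff_le hβ hφ _ _))
  · refine le_add_right ?_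
    gcongr
    push Not at ht
    have hscr : ∀ i, screened β φ w (Fin.tail u) (t i) = screened β φ w' (Fin.tail u) (t i) := by
      intro i
      have := ht i
      rw [screened, screened, hww' 0 (t i) (Metric.mem_ball.2 (by linarith))]
    simp only [hscr]
    rw [← mul_sub, enorm_mul]
    refine (mul_le_of_le_one_left zero_le (hP hw')).trans ?_
    refine le_localityError hw hw' fun i v hv => ?_
    revert hv
    refine Fin.addCases (fun i hv => ?_) (fun i hv => ?_) i
    · rw [Fin.append_left, Metric.mem_ball] at hv
      refine hww' 0 v (Metric.mem_ball.2 ?_)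
      have := dist_triangle v (t i) (u 0)
      have := ht i
      linarith
    · rw [Fin.append_right, Metric.mem_ball] at hv
      exact hww' i.succ v (Metric.mem_ball.2 (by
        have : Fin.tail u i = u i.succ := rfl
        rw [← this]; linarith))

/-- The radius is halved at each exploration, but for given `k` and `m` only finitely many
explorations occur. -/
lemma tendsto_localityError (hβ : 0 ≤ β) (hφ : Measurable φ)
    (hg : ∀ n, vertexIntegral d β φ n < ⊤) (k m : ℕ) :
    Tendsto (localityError d β φ k m) atTop (𝓝 0) := by
  suffices H : ∀ s k m, k + m = s → Tendsto (localityError d β φ k m) atTop (𝓝 0) from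
    H _ k m rfl
  intro s
  induction s using Nat.strong_induction_on with
  | _ s ih =>
  rintro (_ | k) m hs
  · exact tendsto_const_nhds.congr fun h => (localityError_zero m h).symm
  · have hhalf : Tendsto (fun h : ℝ => h / 2) atTop atTop := tendsto_id.atTop_div_const two_pos
    refine tendsto_of_tendsto_of_tendsto_of_le_of_le' tendsto_const_nhds ?_
      (Eventually.of_forall fun h => zero_le)
      ((eventually_ge_atTop 0).mono fun h hh => localityError_succ_le hβ hφ hg k m hh)
    have : (0 : ℝ≥0∞) = ∑ n ∈ range (m + 1), (vertexIntegral d β φ n * 0 +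
        2 * forestCoeff (vertexIntegral d β φ) (n + k) (m - n) * 0) := by simp
    rw [this]
    refine tendsto_finsetSum _ fun n hn => ?_
    have hn' := mem_range.1 hn
    refine (ENNReal.Tendsto.const_mul ((ih (n + k + (m - n)) (by omega) _ _ rfl).comp hhalf)
      (Or.inr (hg n).ne)).add (ENNReal.Tendsto.const_mul
        ((tendsto_vertexTail hφ (hg n)).comp hhalf) (Or.inr ?_))
    exact ENNReal.mul_ne_top (by simp) (forestCoeff_lt_top hg _ _).ne

end Locality

end RepulsiveGas

/-! ### Bulk limits of the pressure coefficients. -/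

namespace RepulsiveGas

open MeasureTheory Finset Filter Topology

section Thermodynamic

variable {d : ℕ} {β : ℝ} {φ : ℝ≥0 → ℝ≥0∞}

lemma isActivity_ball (x : Pos d) (h : ℝ) :
    IsActivity ((Metric.ball x h).indicator fun _ => (1 : ℝ)) :=
  isActivity_indicator measurableSet_ball measure_ball_lt_top

/-- The one-particle ratio coefficient of a ball, at its centre. -/
noncomputable def ballCoeff (d : ℕ) (β : ℝ) (φ : ℝ≥0 → ℝ≥0∞) (m : ℕ) (h : ℝ) : ℝ :=
  ratioCoeff β φ ((Metric.ball (0 : Pos d) h).indicator fun _ => (1 : ℝ)) (fun _ : Fin 1 => 0) m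

lemma ratioCoeff_ball (x : Pos d) (h : ℝ) (m : ℕ) :
    ratioCoeff β φ ((Metric.ball x h).indicator fun _ => (1 : ℝ)) (fun _ : Fin 1 => x) m =
      ballCoeff d β φ m h := by
  have h1 := ratioCoeff_comp_add (β := β) (φ := φ)
    ((Metric.ball x h).indicator fun _ => (1 : ℝ)) x (fun _ : Fin 1 => 0) m
  simp only [zero_add] at h1
  rw [← h1, ballCoeff]
  congr 1
  ext v
  simp [Set.indicator, Metric.mem_ball, dist_eq_norm]

lemma enorm_ratioCoeff_sub_ballCoeff_le {w : Pos d → ℝ} (hw : IsActivity w) {x : Pos d} {h : ℝ}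
    (hx : ∀ v ∈ Metric.ball x h, w v = 1) (m : ℕ) :
    ‖ratioCoeff β φ w (fun _ : Fin 1 => x) m - ballCoeff d β φ m h‖ₑ ≤
      localityError d β φ 1 m h := by
  rw [← ratioCoeff_ball x]
  refine le_localityError hw (isActivity_ball x h) fun _ v hv => ?_
  rw [hx v hv, Set.indicator_of_mem hv]

/-- The infinite volume limit of the one-particle ratio coefficients. -/
lemma exists_bulkCoeff (hβ : 0 ≤ β) (hφ : Measurable φ)
    (hg : ∀ n, vertexIntegral d β φ n < ⊤) (m : ℕ) :
    ∃ c : ℝ, ‖c‖ₑ ≤ forestCoeff (vertexIntegral d β φ) 1 m ∧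
      ∀ h, ‖ballCoeff d β φ m h - c‖ₑ ≤ localityError d β φ 1 m h := by
  have hle : ∀ h h', h ≤ h' →
      ‖ballCoeff d β φ m h - ballCoeff d β φ m h'‖ₑ ≤ localityError d β φ 1 m h := by
    intro h h' hh
    rw [← enorm_neg, neg_sub]
    refine enorm_ratioCoeff_sub_ballCoeff_le (isActivity_ball 0 h') (fun v hv => ?_) m
    rw [Set.indicator_of_mem (Metric.ball_subset_ball hh hv)]
  -- Two concentric balls agree on the smaller one, so the locality error at the smaller radius
  -- controls the difference.
  have hcauchy : CauchySeq fun n : ℕ => ballCoeff d β φ m n := by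
    rw [EMetric.cauchySeq_iff_NNReal]
    intro ε hε
    have ht := ((tendsto_localityError hβ hφ hg 1 m).comp tendsto_natCast_atTop_atTop).eventually
      (gt_mem_nhds (show (0 : ℝ≥0∞) < ε by exact_mod_cast hε))
    obtain ⟨N, hN⟩ := ht.exists
    refine ⟨N, fun n hn => ?_⟩
    rw [edist_comm, edist_eq_enorm_sub]
    exact (hle N n (by exact_mod_cast hn)).trans_lt hN
  obtain ⟨c, hc⟩ := cauchySeq_tendsto_of_complete hcauchy
  refine ⟨c, ?_, fun h => ?_⟩
  · refine le_of_tendsto hc.enorm (Eventually.of_forall fun n => ?_)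
    exact (isActivity_ball (0 : Pos d) n).enorm_ratioCoeff_le hβ hφ _ m
  · refine le_of_tendsto (tendsto_const_nhds.sub hc).enorm ?_
    filter_upwards [eventually_ge_atTop ⌈h⌉₊] with n hn
    exact hle h n ((Nat.le_ceil h).trans (by exact_mod_cast hn))

/-- The ball is connected and misses the frontier, so it lies wholly in the interior or wholly in
the exterior; its centre decides. -/
lemma ball_subset_of_notMem_thickening {Λ : Set (Pos d)} {x : Pos d} {h : ℝ} (hx : x ∈ Λ)
    (hx' : x ∉ Metric.thickening h (frontier Λ)) : Metric.ball x h ⊆ Λ := by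
  rcases le_or_gt h 0 with h0 | h0
  · rw [Metric.ball_eq_empty.2 h0]; exact Set.empty_subset _
  have hfr : ∀ v ∈ Metric.ball x h, v ∉ frontier Λ := fun v hv hf =>
    hx' (Metric.mem_thickening_iff.2 ⟨v, hf, by rw [dist_comm]; exact hv⟩)
  have hsub : Metric.ball x h ⊆ interior Λ ∪ interior Λᶜ := by
    intro v hv
    have := hfr v hv
    rw [frontier_eq_closure_inter_closure] at this
    rw [interior_compl]
    by_cases hc : v ∈ closure Λ
    · left
      have h2 : v ∉ closure Λᶜ := fun h2 => this ⟨hc, h2⟩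
      rw [closure_compl] at h2
      exact not_not.1 h2
    · exact Or.inr hc
  have hxi : x ∈ interior Λ := by
    rcases hsub (Metric.mem_ball_self h0) with h1 | h1
    · exact h1
    · exact absurd hx (interior_subset h1)
  refine Set.Subset.trans ?_ interior_subset
  refine (convex_ball x h).isPreconnected.subset_left_of_subset_union isOpen_interior
    isOpen_interior ?_ hsub ⟨x, Metric.mem_ball_self h0, hxi⟩
  exact disjoint_compl_right.mono interior_subset interior_subset

/-- Up to a boundary term, the coefficients of the finite volume pressure are close to their bulk
values. -/
lemma enorm_logCoeff_sub_le (hβ : 0 ≤ β) (hφ : Measurable φ)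
    (hg : ∀ n, vertexIntegral d β φ n < ⊤) {Λ : Set (Pos d)} (hΛ : IsRegion Λ) {m : ℕ} {c : ℝ} (hc : ‖c‖ₑ ≤ forestCoeff (vertexIntegral d β φ) 1 m)
    (hc' : ∀ h, ‖ballCoeff d β φ m h - c‖ₑ ≤ localityError d β φ 1 m h) (h : ℝ) :
    ‖logCoeff β φ (Λ.indicator fun _ => (1 : ℝ)) m / (volume Λ).toReal - c‖ₑ ≤
      2 * localityError d β φ 1 m h + 2 * forestCoeff (vertexIntegral d β φ) 1 m *
        (volume (Metric.thickening h (frontier Λ)) / volume Λ) := by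
  set w : Pos d → ℝ := Λ.indicator fun _ => (1 : ℝ) with hwdef
  have hw : IsActivity w := isActivity_indicator hΛ.measurable hΛ.finite
  set K := forestCoeff (vertexIntegral d β φ) 1 m
  set q : Pos d → ℝ := fun y => ratioCoeff β φ w (fun _ : Fin 1 => y) m with hq
  have hqm : Measurable q := measurable_ratioCoeff hφ hw (measurable_pi_lambda _ fun _ =>
    measurable_id) m
  have hV0 : (volume Λ).toReal ≠ 0 := (ENNReal.toReal_pos hΛ.pos.ne' hΛ.finite.ne).ne'
  have h1 : logCoeff β φ w m = ∫ y in Λ, q y := by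
    rw [hw.logCoeff_eq_integral hβ hφ, ← integral_indicator hΛ.measurable]
    refine integral_congr_ae (ae_of_all _ fun y => ?_)
    by_cases hy : y ∈ Λ <;> simp [hwdef, hy, hq]
  have hKle : ∀ y, ‖q y - c‖ₑ ≤ 2 * K := fun y => by
    rw [two_mul]
    exact enorm_sub_le.trans (add_le_add (hw.enorm_ratioCoeff_le hβ hφ _ m) hc)
  have hqi : IntegrableOn q Λ := by
    refine IntegrableOn.of_bound hΛ.finite hqm.aestronglyMeasurable K.toReal (ae_of_all _ fun y => ?_)
    exact hw.abs_ratioCoeff_le hβ hφ hg _ m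
  have h2 : logCoeff β φ w m / (volume Λ).toReal - c =
      (∫ y in Λ, (q y - c)) / (volume Λ).toReal := by
    rw [integral_sub hqi (integrableOn_const hΛ.finite.ne), setIntegral_const, h1, Measure.real,
      smul_eq_mul]
    field_simp
  set T := Metric.thickening h (frontier Λ) with hT
  have hTm : MeasurableSet T := Metric.isOpen_thickening.measurableSet
  set E := localityError d β φ 1 m h with hE
  -- In the boundary layer the forest bound is used for both terms. Elsewhere the comparison passes
  -- through the ball around `y`, at the price of one locality error on each side.
  have hpt : ∀ y ∈ Λ, ‖q y - c‖ₑ ≤ 2 * E + T.indicator (fun _ => 2 * K) y := by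
    intro y hy
    by_cases hyT : y ∈ T
    · rw [Set.indicator_of_mem hyT]
      exact le_add_left (hKle y)
    · rw [Set.indicator_of_notMem hyT, add_zero, two_mul]
      have h3 := enorm_ratioCoeff_sub_ballCoeff_le (β := β) (φ := φ) hw (x := y) (h := h)
        (fun v hv => Set.indicator_of_mem (ball_subset_of_notMem_thickening hy hyT hv) _) m
      calc ‖q y - c‖ₑ = ‖(q y - ballCoeff d β φ m h) + (ballCoeff d β φ m h - c)‖ₑ := by
            rw [sub_add_sub_cancel]
        _ ≤ _ := (enorm_add_le _ _).trans (add_le_add h3 (hc' h))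
  have hint : ∫⁻ y in Λ, ‖q y - c‖ₑ ≤ 2 * E * volume Λ + 2 * K * volume T := by
    calc ∫⁻ y in Λ, ‖q y - c‖ₑ ≤ ∫⁻ y in Λ, (2 * E + T.indicator (fun _ => 2 * K) y) :=
          setLIntegral_mono' hΛ.measurable hpt
      _ = 2 * E * volume Λ + ∫⁻ y in Λ, T.indicator (fun _ => 2 * K) y := by
          rw [lintegral_add_left measurable_const, setLIntegral_const]
      _ ≤ 2 * E * volume Λ + 2 * K * volume T := by
          gcongr
          refine (setLIntegral_le_lintegral _ _).trans ?_
          rw [lintegral_indicator_const hTm]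
  have hVe : ‖(volume Λ).toReal‖ₑ = volume Λ := by
    rw [Real.enorm_of_nonneg ENNReal.toReal_nonneg, ENNReal.ofReal_toReal hΛ.finite.ne]
  rw [h2, div_eq_mul_inv, enorm_mul, enorm_inv hV0, hVe, ← div_eq_mul_inv]
  calc _ ≤ (2 * E * volume Λ + 2 * K * volume T) / volume Λ := by
        gcongr
        exact (enorm_integral_le_lintegral_enorm _).trans hint
    _ = _ := by
        rw [ENNReal.add_div, mul_div_assoc, ENNReal.div_self hΛ.pos.ne' hΛ.finite.ne, mul_one,
          mul_div_assoc]

/-- Convergence of the coefficients of the pressure in the thermodynamic limit. -/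
lemma tendsto_logCoeff (hβ : 0 ≤ β) (hφ : Measurable φ)
    (hg : ∀ n, vertexIntegral d β φ n < ⊤) {Λ : ℕ → Set (Pos d)} (hΛ : TendsToSpace Λ) {m : ℕ}
    {c : ℝ} (hc : ‖c‖ₑ ≤ forestCoeff (vertexIntegral d β φ) 1 m)
    (hc' : ∀ h, ‖ballCoeff d β φ m h - c‖ₑ ≤ localityError d β φ 1 m h) :
    Tendsto (fun k => logCoeff β φ ((Λ k).indicator fun _ => (1 : ℝ)) m / (volume (Λ k)).toReal)
      atTop (𝓝 c) := by
  rw [tendsto_iff_edist_tendsto_0, ENNReal.tendsto_nhds_zero]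
  intro ε hε
  have hE : Tendsto (fun h => 2 * localityError d β φ 1 m h) atTop (𝓝 0) := by
    have := ENNReal.Tendsto.const_mul (a := 2) (tendsto_localityError hβ hφ hg 1 m)
      (Or.inr (by simp))
    rwa [mul_zero] at this
  -- The thickness `h` is fixed first from the locality error; only then is the region taken large.
  obtain ⟨h, hh, hh0⟩ := ((ENNReal.tendsto_nhds_zero.1 hE (ε / 2) (ENNReal.half_pos hε.ne')).and
    (eventually_gt_atTop 0)).exists
  have hb := ENNReal.Tendsto.const_mul (a := 2 * forestCoeff (vertexIntegral d β φ) 1 m)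
    (hΛ.boundary h hh0)
    (Or.inr (ENNReal.mul_ne_top (by simp) (forestCoeff_lt_top hg _ _).ne))
  rw [mul_zero] at hb
  filter_upwards [ENNReal.tendsto_nhds_zero.1 hb (ε / 2) (ENNReal.half_pos hε.ne')] with k hk
  rw [edist_eq_enorm_sub]
  calc _ ≤ _ := enorm_logCoeff_sub_le hβ hφ hg (hΛ.region k) hc hc' h
    _ ≤ ε / 2 + ε / 2 := add_le_add hh hk
    _ = ε := ENNReal.add_halves ε

lemma enorm_pressure_term_le (γ : ℕ → ℝ) (z : ℂ) {c : ℝ≥0∞} {n : ℕ}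
    (hγ : ‖γ n‖ₑ ≤ c * forestCoeff (vertexIntegral d β φ) 1 n) :
    ‖(γ n : ℂ) * (z ^ (n + 1) / (n + 1))‖ₑ ≤
      c * (‖z‖ₑ * (‖z‖ₑ ^ n * forestCoeff (vertexIntegral d β φ) 1 n)) := by
  have h1 : ‖z ^ (n + 1) / ((n : ℂ) + 1)‖ₑ ≤ ‖z‖ₑ ^ (n + 1) := by
    rw [← enorm_pow, enorm_le_iff_norm_le, norm_div]
    refine div_le_self (norm_nonneg _) ?_
    have : ((n : ℂ) + 1) = ((n + 1 : ℕ) : ℂ) := by push_cast; rfl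
    rw [this, Complex.norm_natCast]
    exact_mod_cast Nat.succ_pos n
  have h2 : ‖(γ n : ℂ)‖ₑ = ‖γ n‖ₑ := by
    rw [← ofReal_norm, ← ofReal_norm, Complex.norm_real]
  rw [enorm_mul, h2]
  calc _ ≤ c * forestCoeff (vertexIntegral d β φ) 1 n * ‖z‖ₑ ^ (n + 1) := mul_le_mul' hγ h1
    _ = _ := by rw [pow_succ]; ring

lemma enorm_tsum_pressure_le (γ : ℕ → ℝ) (z : ℂ) {c : ℝ≥0∞}
    (hγ : ∀ n, ‖γ n‖ₑ ≤ c * forestCoeff (vertexIntegral d β φ) 1 n) :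
    ‖∑' n : ℕ, (γ n : ℂ) * (z ^ (n + 1) / (n + 1))‖ₑ ≤
      c * (‖z‖ₑ * ∑' n, ‖z‖ₑ ^ n * forestCoeff (vertexIntegral d β φ) 1 n) := by
  refine enorm_tsum_le_tsum_enorm.trans ?_
  rw [← ENNReal.tsum_mul_left, ← ENNReal.tsum_mul_left]
  exact ENNReal.tsum_le_tsum fun n => enorm_pressure_term_le γ z (hγ n)

end Thermodynamic

end RepulsiveGas

/-! ### Finite-volume pressure and its thermodynamic limit. -/

namespace RepulsiveGas

open MeasureTheory Finset Filter Topology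

section Pressure

variable {d : ℕ} {β : ℝ} {φ : ℝ≥0 → ℝ≥0∞}

lemma IsActivity.summable_logCoeff {w : Pos d → ℝ} (hw : IsActivity w) (hβ : 0 ≤ β)
    (hφ : Measurable φ) {z : ℂ}
    (hS : ∑' n, ‖z‖ₑ ^ n * forestCoeff (vertexIntegral d β φ) 1 n < ⊤) {ζ : ℂ} (hζ : ‖ζ‖ ≤ ‖z‖) :
    Summable fun n => |logCoeff β φ w n| * ‖ζ‖ ^ n := by
  have h : ∑' n, ‖logCoeff β φ w n‖ₑ * ‖z‖ₑ ^ n < ⊤ := by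
    refine lt_of_le_of_lt ?_ (ENNReal.mul_lt_top (ENNReal.ofReal_lt_top (r := ∫ u, w u)) hS)
    rw [← ENNReal.tsum_mul_left]
    refine ENNReal.tsum_le_tsum fun n => ?_
    rw [mul_comm (‖z‖ₑ ^ n), ← mul_assoc]
    gcongr
    exact hw.enorm_logCoeff_le hβ hφ n
  refine Summable.of_nonneg_of_le (fun n => by positivity) (fun n => ?_)
    (ENNReal.summable_toReal h.ne)
  rw [ENNReal.toReal_mul, ENNReal.toReal_pow, toReal_enorm, toReal_enorm, Real.norm_eq_abs]
  gcongr

lemma integral_indicator_region {Λ : Set (Pos d)} (hΛ : IsRegion Λ) :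
    ∫ u, Λ.indicator (fun _ => (1 : ℝ)) u = (volume Λ).toReal := by
  rw [integral_indicator hΛ.measurable]
  simp [Measure.real]

lemma IsRegion.isActivity {Λ : Set (Pos d)} (hΛ : IsRegion Λ) :
    IsActivity (Λ.indicator fun _ => (1 : ℝ)) := isActivity_indicator hΛ.measurable hΛ.finite

lemma IsRegion.toReal_ne_zero {Λ : Set (Pos d)} (hΛ : IsRegion Λ) : (volume Λ).toReal ≠ 0 :=
  (ENNReal.toReal_pos hΛ.pos.ne' hΛ.finite.ne).ne'

lemma IsRegion.enorm_logCoeff_div_le {Λ : Set (Pos d)} (hΛ : IsRegion Λ) (hβ : 0 ≤ β)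
    (hφ : Measurable φ) (n : ℕ) :
    ‖logCoeff β φ (Λ.indicator fun _ => (1 : ℝ)) n / (volume Λ).toReal‖ₑ ≤
      1 * forestCoeff (vertexIntegral d β φ) 1 n := by
  have h := hΛ.isActivity.enorm_logCoeff_le hβ hφ n
  rw [integral_indicator_region hΛ, ENNReal.ofReal_toReal hΛ.finite.ne] at h
  rw [div_eq_mul_inv, enorm_mul, enorm_inv hΛ.toReal_ne_zero,
    Real.enorm_of_nonneg ENNReal.toReal_nonneg, ENNReal.ofReal_toReal hΛ.finite.ne,
    ← div_eq_mul_inv, one_mul]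
  exact ENNReal.div_le_of_le_mul' h

lemma IsRegion.partitionFunction_ne_zero {Λ : Set (Pos d)} (hΛ : IsRegion Λ) (hβ : 0 ≤ β)
    (hφ : Measurable φ) {z : ℂ}
    (hS : ∑' n, ‖z‖ₑ ^ n * forestCoeff (vertexIntegral d β φ) 1 n < ⊤) {ζ : ℂ} (hζ : ‖ζ‖ ≤ ‖z‖) :
    partitionFunction β φ Λ ζ ≠ 0 := by
  rw [partitionFunction_eq_powerSum hΛ.measurable]
  exact powerSum_ne_zero (hΛ.isActivity.abs_configIntegral_div_le hβ hφ) (by simp)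
    (logCoeff_recurrence _) (hΛ.isActivity.summable_logCoeff hβ hφ hS hζ)

lemma IsRegion.exp_betaPressure {Λ : Set (Pos d)} (hΛ : IsRegion Λ) (hβ : 0 ≤ β)
    (hφ : Measurable φ) {z : ℂ}
    (hS : ∑' n, ‖z‖ₑ ^ n * forestCoeff (vertexIntegral d β φ) 1 n < ⊤) :
    Complex.exp (((volume Λ).toReal : ℂ) * betaPressure β φ Λ z) = partitionFunction β φ Λ z := by
  rw [betaPressure, mul_div_cancel₀ _ (by exact_mod_cast hΛ.toReal_ne_zero),
    partitionFunction_eq_powerSum hΛ.measurable]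
  exact exp_logFromOrigin_powerSum (hΛ.isActivity.abs_configIntegral_div_le hβ hφ) (by simp)
    (logCoeff_recurrence _) (hΛ.isActivity.summable_logCoeff hβ hφ hS le_rfl)

lemma IsRegion.betaPressure_eq_tsum {Λ : Set (Pos d)} (hΛ : IsRegion Λ) (hβ : 0 ≤ β)
    (hφ : Measurable φ) {z : ℂ}
    (hS : ∑' n, ‖z‖ₑ ^ n * forestCoeff (vertexIntegral d β φ) 1 n < ⊤) :
    betaPressure β φ Λ z = ∑' n : ℕ,
      ((logCoeff β φ (Λ.indicator fun _ => (1 : ℝ)) n / (volume Λ).toReal : ℝ) : ℂ) *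
        (z ^ (n + 1) / (n + 1)) := by
  rw [betaPressure, partitionFunction_eq_powerSum hΛ.measurable,
    logFromOrigin_powerSum_eq_tsum (hΛ.isActivity.abs_configIntegral_div_le hβ hφ) (by simp)
    (logCoeff_recurrence _) (hΛ.isActivity.summable_logCoeff hβ hφ hS le_rfl), ← tsum_div_const]
  refine tsum_congr fun n => ?_
  push_cast
  ring

lemma IsRegion.enorm_betaPressure_le {Λ : Set (Pos d)} (hΛ : IsRegion Λ) (hβ : 0 ≤ β)
    (hφ : Measurable φ) {z : ℂ}
    (hS : ∑' n, ‖z‖ₑ ^ n * forestCoeff (vertexIntegral d β φ) 1 n < ⊤) :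
    ‖betaPressure β φ Λ z‖ₑ ≤ ‖z‖ₑ * treeSum d β φ ‖z‖ₑ := by
  rw [hΛ.betaPressure_eq_tsum hβ hφ hS, treeSum_eq hβ hφ]
  have h := enorm_tsum_pressure_le (d := d) (β := β) (φ := φ) _ z
    (hΛ.enorm_logCoeff_div_le hβ hφ)
  rwa [one_mul] at h

/-- Existence of the thermodynamic pressure. -/
lemma exists_isThermodynamicPressure (hβ : 0 ≤ β) (hφ : Measurable φ)
    (hg : ∀ n, vertexIntegral d β φ n < ⊤) {z : ℂ}
    (hS : ∑' n, ‖z‖ₑ ^ n * forestCoeff (vertexIntegral d β φ) 1 n < ⊤) :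
    ∃ q : ℂ, IsThermodynamicPressure d β φ z q ∧ ‖q‖ₑ ≤ ‖z‖ₑ * treeSum d β φ ‖z‖ₑ := by
  choose c hc hc' using exists_bulkCoeff (d := d) hβ hφ hg
  refine ⟨∑' n : ℕ, (c n : ℂ) * (z ^ (n + 1) / (n + 1)), fun Λ hΛ => ?_, ?_⟩
  · simp_rw [fun k => (hΛ.region k).betaPressure_eq_tsum hβ hφ hS]
    have hsum : ∑' n, ‖z‖ₑ * (‖z‖ₑ ^ n * forestCoeff (vertexIntegral d β φ) 1 n) ≠ ⊤ := by
      rw [ENNReal.tsum_mul_left]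
      exact ENNReal.mul_ne_top enorm_ne_top hS.ne
    -- The majorant is the tree series, the same for every region, so convergence of each
    -- coefficient suffices.
    refine tendsto_tsum_of_dominated_convergence (ENNReal.summable_toReal hsum) (fun n => ?_)
      (Eventually.of_forall fun k n => ?_)
    · refine Tendsto.mul_const _ ?_
      exact (Complex.continuous_ofReal.tendsto _).comp (tendsto_logCoeff hβ hφ hg hΛ (hc n) (hc' n))
    · have h := enorm_pressure_term_le (d := d) (β := β) (φ := φ) (n := n)
        (fun n => logCoeff β φ ((Λ k).indicator fun _ => (1 : ℝ)) n / (volume (Λ k)).toReal) z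
        ((hΛ.region k).enorm_logCoeff_div_le hβ hφ n)
      rw [one_mul] at h
      rw [← toReal_enorm]
      exact ENNReal.toReal_mono (ENNReal.ne_top_of_tsum_ne_top hsum n) h
  · have h := enorm_tsum_pressure_le (d := d) (β := β) (φ := φ) c z (c := 1)
      (fun n => by rw [one_mul]; exact hc n)
    rwa [one_mul, ← treeSum_eq hβ hφ] at h

end Pressure

end RepulsiveGas

/-! ### The main theorem. -/

theorem mainTheorem5 (d : ℕ) (hd : 1 ≤ d) (β : ℝ) (hβ : 0 < β)
    (φ : ℝ≥0 → ℝ≥0∞) (hφ : Measurable φ) (hC : RepulsiveGas.tempering d β φ < ⊤)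
    (z : ℂ) (μ : ℝ≥0) (hμ : 0 < μ)
    (hz : ‖z‖ₑ ≤ (μ : ℝ≥0∞) / RepulsiveGas.vertexSum d β φ μ) :
    -- the finite-volume pressures are well defined and bounded, for all regions
    (∀ Λ : Set (RepulsiveGas.Pos d), RepulsiveGas.IsRegion Λ →
      (∀ ζ : ℂ, ‖ζ‖ ≤ ‖z‖ → RepulsiveGas.partitionFunction β φ Λ ζ ≠ 0) ∧
      Complex.exp (((MeasureTheory.volume Λ).toReal : ℂ) * RepulsiveGas.betaPressure β φ Λ z) =
        RepulsiveGas.partitionFunction β φ Λ z ∧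
      ‖RepulsiveGas.betaPressure β φ Λ z‖ₑ ≤ ‖z‖ₑ * RepulsiveGas.treeSum d β φ ‖z‖ₑ) ∧
    -- the thermodynamic pressure exists and is bounded
    (∃ q : ℂ, RepulsiveGas.IsThermodynamicPressure d β φ z q ∧
      ‖q‖ₑ ≤ ‖z‖ₑ * RepulsiveGas.treeSum d β φ ‖z‖ₑ) ∧
    ‖z‖ₑ * RepulsiveGas.treeSum d β φ ‖z‖ₑ ≤ μ ∧
    -- the iterates of the vertex map
    (∀ x : ℝ≥0∞, x < ⊤ → RepulsiveGas.vertexMap d β φ z x < ⊤) ∧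
    Antitone (fun n : ℕ => (RepulsiveGas.vertexMap d β φ z)^[n] μ) ∧
    (z ≠ 0 → RepulsiveGas.tempering d β φ ≠ 0 →
      ‖z‖ₑ < (μ : ℝ≥0∞) / RepulsiveGas.vertexSum d β φ μ →
      StrictAnti (fun n : ℕ => (RepulsiveGas.vertexMap d β φ z)^[n] μ)) ∧
    ∃ L : ℝ≥0∞,
      Filter.Tendsto (fun n : ℕ => (RepulsiveGas.vertexMap d β φ z)^[n] μ)
        Filter.atTop (nhds L) ∧
      RepulsiveGas.vertexMap d β φ z L = L ∧
      ‖z‖ₑ * RepulsiveGas.treeSum d β φ ‖z‖ₑ ≤ L ∧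
      (∀ n : ℕ, L ≤ (RepulsiveGas.vertexMap d β φ z)^[n] μ) := by
  open RepulsiveGas in
  have hβ' := hβ.le
  have hμt : (μ : ℝ≥0∞) < ⊤ := ENNReal.coe_lt_top
  have hsup : vertexMap d β φ z μ ≤ μ := vertexMap_le_of_le_div hz
  have hg : ∀ n, vertexIntegral d β φ n < ⊤ := fun n =>
    (vertexIntegral_le hβ' hφ hC n).trans_lt (ENNReal.pow_lt_top hC)
  have hS : ∑' n, ‖z‖ₑ ^ n * forestCoeff (vertexIntegral d β φ) 1 n < ⊤ :=
    (tsum_forestCoeff_one_le hsup).trans_lt (vertexSum_lt_top hβ' hφ hC hμt)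
  -- Stated for every supersolution because it is used twice: at μ and at the fixed point `L`.
  have htree : ∀ y, vertexMap d β φ z y ≤ y → ‖z‖ₑ * treeSum d β φ ‖z‖ₑ ≤ y := fun y hy => by
    rw [treeSum_eq hβ' hφ]
    exact mul_tsum_forestCoeff_one_le hy
  obtain ⟨L, hL, hfix, hle⟩ := tendsto_iterate_vertexMap hβ' hφ hC hμt hsup
  refine ⟨fun Λ hΛ => ⟨fun ζ hζ => hΛ.partitionFunction_ne_zero hβ' hφ hS hζ,
    hΛ.exp_betaPressure hβ' hφ hS, hΛ.enorm_betaPressure_le hβ' hφ hS⟩,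
    exists_isThermodynamicPressure hβ' hφ hg hS, htree μ hsup,
    fun x hx => vertexMap_lt_top hβ' hφ hC z hx,
    (vertexMap_mono z).antitone_iterate_of_map_le hsup, fun hz0 hC0 hlt => ?_,
    L, hL, hfix, htree L hfix.le, hle⟩
  refine strictAnti_nat_of_succ_lt fun n => ?_
  rw [Function.iterate_succ_apply]
  -- The strict inequality Π_z(μ) < μ is transported by the n-th iterate, which is strictly
  -- monotone.
  exact (vertexMap_strictMono hβ' hφ hC hC0 hz0).iterate n (vertexMap_lt_of_lt_div hlt)
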